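/- Let $b\in(0,1)$ and let $$\Gamma=\{(x_1,x_2)\in\mathbb R^2:\ |x_2|\ge |x_1|^b\ \text{ or }\ |x_1|\ge |x_2|^b\}.$$ For $\alpha\in(0,2)$ put $\beta=\alpha-1+1/b$ and $$k_\alpha(z)=(2-\alpha)\,\mathbf 1_{\Gamma\cap B_1}(z)\,|z|^{-2-\beta}\quad(z\in\mathbb R^2),\qquad k_\alpha(x,y)=k_\alpha(x-y),$$ where $B_r=\{z\in\mathbb R^2:|z|<r\}$. Then the following hold. (0) For every $\alpha\in(0,2)$ the kernel $k_\alpha$ is nonnegative, measurable and symmetric, and there are measurable functions $L,U:\mathbb R^2\to[0,\infty)$, even almost everywhere, with $L(x-y)\le k_\alpha(x,y)\le U(x-y)$ for almost every $x,y$, with $L\ne0$ on a set of positive measure, and with $\int_{\mathbb R^2}(|z|^2\wedge1)\,U(z)\,dz<\infty$. (A) For every $\alpha_0\in(0,2)$ there are constants $c_1,c_2>0$ such that for all $\alpha\in(\alpha_0,2)$, all balls $B\subset\mathbb R^2$ of radius $r\in(0,1)$ and all $u\in C_c^\infty(B)$, $$c_1(2-\alpha)\int_B\int_B\frac{(u(y)-u(x))^2}{|x-y|^{2+\alpha}}\,dy\,dx\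 \le\ \int_B\int_B (u(y)-u(x))^2\,k_\alpha(x,y)\,dy\,dx\ \le\ c_2(2-\alpha)\int_B\int_B\frac{(u(y)-u(x))^2}{|x-y|^{2+\alpha}}\,dy\,dx .$$ (B) For every $\alpha_0\in(0,2)$ there is a constant $c>0$ such that for all $R,\rho\in(0,1)$ there is a nonnegative $\tau\in C^\infty(\mathbb R^2)$ with $\operatorname{supp}\tau=\overline{B_{R+\rho}}$ and $\tau=1$ on $B_R$ such that for all $\alpha\in(\alpha_0,2)$ $$\operatorname*{ess\,sup}_{x\in\mathbb R^2}\int_{\mathbb R^2}(\tau(y)-\tau(x))^2\,k_\alpha(x,y)\,dy\ \le\ c\,\rho^{-\alpha}.$$ (not L1) For no $\alpha\in(0,2)$ does $k_\alpha$ satisfy the following condition (L1): there are a function $L:\mathbb R^2\to[0,\infty)$, even almost everywhere, with $L(x-y)\le k_\alpha(x,y)$ for almost every $x,y$, and constants $a>1$, $C_2,C_3>0$ such that for every $n=0,1,2,\dots$ the annulus $B_{a^{-n+1}}\setminus B_{a^{-n}}$ contains a ball of radius $C_2a^{-n}$ on which $L(z)\ge C_3(2-\alpha)|z|^{-2-\alpha}$.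 Moreover, for every $n_0\in\mathbb N$ this remains true when the condition is required only for the annuli with $n\ge n_0$. In particular, (L1) is not necessary for (A) and (B). -/

import Mathlib

open MeasureTheory Set
open scoped ENNReal ContDiff

namespace NonlocalForms

/-- Euclidean space `ℝ^d`. -/
abbrev E (d : ℕ) : Type := EuclideanSpace ℝ (Fin d)

/-- The quadratic form `∫_D ∫_D (u(y) - u(x))² k(x,y) dy dx`, with values in `[0,∞]`. -/
noncomputable def energy {d : ℕ} (k : E d → E d → ℝ) (D : Set (E d)) (u : E d → ℝ) : ℝ≥0∞ :=
  ∫⁻ x in D, ∫⁻ y in D, ENNReal.ofReal ((u y - u x) ^ 2 * k x y)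

/-- The kernel `(2 - α) |x - y|^{-d-α}`. -/
noncomputable def stableKernel (d : ℕ) (α : ℝ) (x y : E d) : ℝ :=
  (2 - α) * ‖x - y‖ ^ (-(d : ℝ) - α)

/-- Membership `u ∈ C_c^∞(D)`, for `D` open. -/
def IsTestFunction {d : ℕ} (D : Set (E d)) (u : E d → ℝ) : Prop :=
  ContDiff ℝ ∞ u ∧ HasCompactSupport u ∧ tsupport u ⊆ D

/-- Condition (A) for a family of kernels `k α`, `α ∈ (α₀, 2)`: the forms of `k α` and of
`(2 - α)|x - y|^{-d-α}` are comparable on every ball `B` of radius less than one, for every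
`u ∈ C_c^∞(B)`, with positive constants that do not depend on `α`, `B` and `u`. -/
def CondA {d : ℕ} (α₀ : ℝ) (k : ℝ → E d → E d → ℝ) : Prop :=
  ∃ c₁ c₂ : ℝ, 0 < c₁ ∧ 0 < c₂ ∧
    ∀ α ∈ Ioo α₀ 2, ∀ (x₀ : E d), ∀ r ∈ Ioo (0 : ℝ) 1, ∀ u : E d → ℝ,
      IsTestFunction (Metric.ball x₀ r) u →
        ENNReal.ofReal c₁ * energy (stableKernel d α) (Metric.ball x₀ r) u
            ≤ energy (k α) (Metric.ball x₀ r) u ∧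
        energy (k α) (Metric.ball x₀ r) u
            ≤ ENNReal.ofReal c₂ * energy (stableKernel d α) (Metric.ball x₀ r) u

/-- Condition (B) for a family of kernels `k α`, `α ∈ (α₀, 2)`: existence of cut-off functions,
the same for all `α`, with one constant `c`. -/
def CondB {d : ℕ} (α₀ : ℝ) (k : ℝ → E d → E d → ℝ) : Prop :=
  ∃ c : ℝ, 0 < c ∧ ∀ R ∈ Ioo (0 : ℝ) 1, ∀ ρ ∈ Ioo (0 : ℝ) 1,
    ∃ τ : E d → ℝ, ContDiff ℝ ∞ τ ∧ (∀ x, 0 ≤ τ x) ∧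
      tsupport τ = closure (Metric.ball 0 (R + ρ)) ∧
      (∀ x ∈ Metric.ball (0 : E d) R, τ x = 1) ∧
      ∀ α ∈ Ioo α₀ 2,
        essSup (fun x => ∫⁻ y, ENNReal.ofReal ((τ y - τ x) ^ 2 * k α x y)) volume
          ≤ ENNReal.ofReal (c * ρ ^ (-α))

/-- `L ≥ 0` is even almost everywhere, and `L(x - y) ≤ k(x,y)` for almost every `x, y`. -/
def IsLowerEnvelope {d : ℕ} (k : E d → E d → ℝ) (L : E d → ℝ) : Prop :=
  (∀ z, 0 ≤ L z) ∧ (∀ᵐ z, L (-z) = L z) ∧ ∀ᵐ p : E d × E d, L (p.1 - p.2) ≤ k p.1 p.2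

/-- `U ≥ 0` is even almost everywhere, and `k(x,y) ≤ U(x - y)` for almost every `x, y`. -/
def IsUpperEnvelope {d : ℕ} (k : E d → E d → ℝ) (U : E d → ℝ) : Prop :=
  (∀ z, 0 ≤ U z) ∧ (∀ᵐ z, U (-z) = U z) ∧ ∀ᵐ p : E d × E d, k p.1 p.2 ≤ U (p.1 - p.2)

/-- The standing assumptions on a kernel: it is nonnegative, measurable and symmetric, and
`L(x - y) ≤ k(x,y) ≤ U(x - y)` where `L` does not vanish almost everywhere and
`∫ (|z|² ∧ 1) U(z) dz < ∞`. -/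
def IsAdmissible {d : ℕ} (k : E d → E d → ℝ) : Prop :=
  (∀ x y, 0 ≤ k x y) ∧ Measurable (Function.uncurry k) ∧ (∀ x y, k x y = k y x) ∧
    ∃ L U : E d → ℝ, Measurable L ∧ Measurable U ∧ IsLowerEnvelope k L ∧ IsUpperEnvelope k U ∧
      0 < volume {z | L z ≠ 0} ∧
      ∫⁻ z, ENNReal.ofReal (min (‖z‖ ^ 2) 1 * U z) < ⊤

/-- The annulus condition on `L` for all indices `n ≥ n₀`: every annulus
`B_{a^{-n+1}} \ B_{a^{-n}}`, `n ≥ n₀`, contains a ball of radius `C₂ a^{-n}` on which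
`L(z) ≥ C₃ (2 - α) |z|^{-d-α}`. -/
def AnnulusCondFrom {d : ℕ} (n₀ : ℕ) (α : ℝ) (L : E d → ℝ) : Prop :=
  ∃ a C₂ C₃ : ℝ, 1 < a ∧ 0 < C₂ ∧ 0 < C₃ ∧ ∀ n : ℕ, n₀ ≤ n →
    ∃ w : E d,
      Metric.ball w (C₂ * a ^ (-(n : ℤ))) ⊆
        Metric.ball 0 (a ^ (-(n : ℤ) + 1)) \ Metric.ball 0 (a ^ (-(n : ℤ))) ∧
      ∀ z ∈ Metric.ball w (C₂ * a ^ (-(n : ℤ))),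
        C₃ * (2 - α) * ‖z‖ ^ (-(d : ℝ) - α) ≤ L z

/-- The kernel `k` satisfies (L1) restricted to the annuli with index `n ≥ n₀`, for some lower
envelope `L`. -/
def SatisfiesL1From {d : ℕ} (n₀ : ℕ) (α : ℝ) (k : E d → E d → ℝ) : Prop :=
  ∃ L : E d → ℝ, IsLowerEnvelope k L ∧ AnnulusCondFrom n₀ α L

/-- The kernel `k` satisfies (L1): all annuli, `n = 0, 1, 2, …`. -/
def SatisfiesL1 {d : ℕ} (α : ℝ) (k : E d → E d → ℝ) : Prop :=
  SatisfiesL1From 0 α k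

/-- The set `Γ = {|x₂| ≥ |x₁|^b or |x₁| ≥ |x₂|^b}` in the plane. -/
def thornSet (b : ℝ) : Set (E 2) :=
  {z | |z 0| ^ b ≤ |z 1| ∨ |z 1| ^ b ≤ |z 0|}

open Classical in
/-- The function `(2 - α) 1_{Γ ∩ B₁}(z) |z|^{-2-β}` with `β = α - 1 + 1/b`. -/
noncomputable def thornFunction (b α : ℝ) (z : E 2) : ℝ :=
  if z ∈ thornSet b ∩ Metric.ball 0 1 then (2 - α) * ‖z‖ ^ (-2 - (α - 1 + 1 / b)) else 0

/-- The translation invariant kernel `k(x,y) = k(x - y)` of the thorn function. -/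
noncomputable def thornKernel (b α : ℝ) (x y : E 2) : ℝ :=
  thornFunction b α (x - y)

end NonlocalForms

namespace NonlocalForms

/-! In `thornSet b` the short coordinate is at most the `1/b`-th power of the long one, so the part
of the thorn set inside `B_ρ` has area at most a constant times `ρ^(1+1/b)`, against `ρ²` for the
full disc. The exponent `β = α - 1 + 1/b` compensates exactly: `ρ^(-2-β) ρ^(1+1/b) = ρ^(-2-α) ρ²`.
At every scale the thorn kernel therefore has mass at most of stable order, concentrated on a set
that becomes negligible as the scale decreases.

Three assertions follow from this count. The moment bound in (0) and (B) reduce to `∫ min(t²/ρ², 1)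
t^(-1-α) dt` on `(0,1]`, whose blow-up as `α → 2` is cancelled by the factor `2 - α`
(`lintegral_min_mul_thornFunction_le`). Condition (L1) would place balls of area of order `a^(-2n)`
inside a set of area of order `a^(-n(1+1/b))`, which is impossible for large `n`.

For (A), a jump from `x` to `y` is replaced by an average over chains of jumps inside the same ball.
By convexity of the square and Tonelli, the forms compare as soon as each marginal of the chain
density, with one step fixed, is bounded by the other kernel (`lintegral_sqDiff_le_of_chain_two`,
`lintegral_sqDiff_le_of_chain_three`).

For the upper bound, a thorn jump is split at a random point near the midpoint of its endpoints.
Fixing one half and integrating the other endpoint over the thorn set yields the stable kernel. For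
the lower bound, the same splitting, iterated, first reduces the stable form to jumps that are short
relative to the radius and point away from the axes. Such a jump is then made in three nearly
axis-parallel steps in the thorn set: inwards, sideways, and back. All constants in (A) depend on
`b` alone. -/

/-! ### Coordinates in the plane and the area of the thorn set -/

lemma measurePreserving_coords :
    MeasurePreserving (fun z : E 2 => (z 0, z 1)) volume volume :=
  (volume_preserving_finTwoArrow ℝ).comp
    (PiLp.volume_preserving_ofLp (Fin 2))

lemma measurePreserving_coords_swap :
    MeasurePreserving (fun z : E 2 => (z 1, z 0)) volume volume :=
  Measure.measurePreserving_swap.comp measurePreserving_coords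

lemma volume_box {i j : Fin 2} (hij : i ≠ j) {s t : Set ℝ} (hs : MeasurableSet s)
    (ht : MeasurableSet t) : volume {z : E 2 | z i ∈ s ∧ z j ∈ t} = volume s * volume t := by
  have key : MeasurePreserving (fun z : E 2 => (z i, z j)) volume volume := by
    fin_cases i <;> fin_cases j
    · exact absurd rfl hij
    · exact measurePreserving_coords
    · exact measurePreserving_coords_swap
    · exact absurd rfl hij
  have h := key.measure_preimage (hs.prod ht).nullMeasurableSet
  rw [Measure.volume_eq_prod, Measure.prod_prod] at h
  exact h

lemma norm_sq_eq (z : E 2) {i j : Fin 2} (hij : i ≠ j) : ‖z‖ ^ 2 = z i ^ 2 + z j ^ 2 := by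
  rw [EuclideanSpace.norm_sq_eq, Fin.sum_univ_two]
  fin_cases i <;> fin_cases j <;> simp_all [add_comm]

lemma abs_coord_le_norm (z : E 2) (i : Fin 2) : |z i| ≤ ‖z‖ := by
  simpa using PiLp.norm_apply_le z i

lemma norm_le_add_abs (z : E 2) {i j : Fin 2} (hij : i ≠ j) : ‖z‖ ≤ |z i| + |z j| := by
  refine abs_le_of_sq_le_sq' ?_ (by positivity) |>.2
  rw [norm_sq_eq z hij, ← sq_abs (z i), ← sq_abs (z j)]
  nlinarith [mul_nonneg (abs_nonneg (z i)) (abs_nonneg (z j))]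

lemma volume_closedBall_le (c : E 2) {ρ : ℝ} (hρ : 0 ≤ ρ) :
    volume (Metric.closedBall c ρ) ≤ ENNReal.ofReal (4 * ρ ^ 2) := by
  have hsub : Metric.closedBall c ρ ⊆
      {z : E 2 | z 0 ∈ Icc (c 0 - ρ) (c 0 + ρ) ∧ z 1 ∈ Icc (c 1 - ρ) (c 1 + ρ)} := by
    intro z hz
    rw [mem_closedBall_iff_norm] at hz
    have h := fun i => abs_le.1 ((abs_coord_le_norm (z - c) i).trans hz)
    have h0 := h 0
    have h1 := h 1
    simp only [PiLp.sub_apply] at h0 h1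
    exact ⟨⟨by linarith, by linarith⟩, ⟨by linarith, by linarith⟩⟩
  refine (measure_mono hsub).trans ?_
  rw [volume_box (by decide) measurableSet_Icc measurableSet_Icc, Real.volume_Icc,
    Real.volume_Icc, ← ENNReal.ofReal_mul (by linarith)]
  exact ENNReal.ofReal_le_ofReal (by nlinarith)

lemma measurableSet_thornSet (b : ℝ) : MeasurableSet (thornSet b) := by
  have h : ∀ i : Fin 2, Measurable fun z : E 2 => |z i| := fun i => by fun_prop
  exact (measurableSet_le ((h 0).pow_const b) (h 1)).union
    (measurableSet_le ((h 1).pow_const b) (h 0))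

lemma mem_thornSet_of {b : ℝ} {z : E 2} {i j : Fin 2} (hij : i ≠ j) (h : |z i| ^ b ≤ |z j|) :
    z ∈ thornSet b := by
  fin_cases i <;> fin_cases j
  · exact absurd rfl hij
  · exact Or.inl h
  · exact Or.inr h
  · exact absurd rfl hij

lemma neg_mem_thornSet {b : ℝ} {z : E 2} : -z ∈ thornSet b ↔ z ∈ thornSet b := by
  simp [thornSet]

lemma abs_le_rpow_of_rpow_le {b s t : ℝ} (hb : 0 < b) (h : |s| ^ b ≤ |t|) :
    |s| ≤ |t| ^ (1 / b) := by
  have := Real.rpow_le_rpow (by positivity) h (by positivity : (0 : ℝ) ≤ 1 / b)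
  rwa [← Real.rpow_mul (abs_nonneg s), mul_one_div_cancel hb.ne', Real.rpow_one] at this

/-- Inside the ball the long coordinate is at most `ρ`, hence the short one at most `ρ^(1/b)`. Two
rectangles, one per axis, cover the set. This is the only area estimate for the thorns, and it
drives the upper bounds as well as the failure of (L1). -/
lemma volume_thornSet_inter_closedBall_le {b : ℝ} (hb : 0 < b) {ρ : ℝ} (hρ : 0 ≤ ρ) :
    volume (thornSet b ∩ Metric.closedBall 0 ρ) ≤ ENNReal.ofReal (8 * ρ ^ (1 + 1 / b)) := by
  set N := ρ ^ (1 / b)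
  have hN : 0 ≤ N := by positivity
  have aux : ∀ i j : Fin 2, ∀ z ∈ Metric.closedBall (0 : E 2) ρ, |z i| ^ b ≤ |z j| →
      z i ∈ Icc (-N) N ∧ z j ∈ Icc (-ρ) ρ := by
    intro i j z hz h
    have hz' := (abs_coord_le_norm z j).trans (mem_closedBall_zero_iff.1 hz)
    refine ⟨abs_le.1 ((abs_le_rpow_of_rpow_le hb h).trans ?_), abs_le.1 hz'⟩
    exact Real.rpow_le_rpow (abs_nonneg _) hz' (by positivity)
  have hsub : thornSet b ∩ Metric.closedBall 0 ρ ⊆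
      {z : E 2 | z 0 ∈ Icc (-N) N ∧ z 1 ∈ Icc (-ρ) ρ} ∪
        {z : E 2 | z 1 ∈ Icc (-N) N ∧ z 0 ∈ Icc (-ρ) ρ} := by
    rintro z ⟨h | h, hz⟩
    · exact Or.inl (aux 0 1 z hz h)
    · exact Or.inr (aux 1 0 z hz h)
  refine (measure_mono hsub).trans ((measure_union_le _ _).trans ?_)
  rw [volume_box (by decide) measurableSet_Icc measurableSet_Icc,
    volume_box (by decide) measurableSet_Icc measurableSet_Icc, Real.volume_Icc, Real.volume_Icc,
    ← ENNReal.ofReal_mul (by linarith), ← ENNReal.ofReal_add (mul_nonneg (by linarith) (by linarith))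
      (mul_nonneg (by linarith) (by linarith))]
  refine ENNReal.ofReal_le_ofReal (le_of_eq ?_)
  rw [Real.rpow_add_of_nonneg hρ zero_le_one (by positivity), Real.rpow_one]
  ring

/-! ### One-dimensional power integrals -/

lemma lintegral_rpow_Ioc {s t p : ℝ} (hst : s ≤ t)
    (h : -1 < p ∨ p ≠ -1 ∧ (0 : ℝ) ∉ uIcc s t) (hs : 0 ≤ s) :
    ∫⁻ x in Ioc s t, ENNReal.ofReal (x ^ p)
      = ENNReal.ofReal ((t ^ (p + 1) - s ^ (p + 1)) / (p + 1)) := by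
  have hint : IntervalIntegrable (fun x : ℝ => x ^ p) volume s t := by
    rcases h with h | h
    · exact intervalIntegral.intervalIntegrable_rpow' h
    · exact intervalIntegral.intervalIntegrable_rpow (Or.inr h.2)
  rw [← integral_rpow h, intervalIntegral.integral_of_le hst,
    ofReal_integral_eq_lintegral_ofReal ((intervalIntegrable_iff_integrableOn_Ioc_of_le hst).1 hint)]
  filter_upwards [ae_restrict_mem measurableSet_Ioc] with x hx
  exact Real.rpow_nonneg (hs.trans hx.1.le) p

/-- Splitting at `t = ρ` gives `1/(2-α)` from the quadratic part and `1/α` from the tail. The first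
term is kept explicit because the kernel's factor `2 - α` has to cancel it. -/
lemma lintegral_min_rpow_le {α ρ : ℝ} (hα : α ∈ Ioo (0 : ℝ) 2) (hρ : ρ ∈ Ioc (0 : ℝ) 1) :
    ∫⁻ t in Ioc (0 : ℝ) 1, ENNReal.ofReal (min (t ^ 2 / ρ ^ 2) 1 * t ^ (-1 - α))
      ≤ ENNReal.ofReal (ρ ^ (-α) * (1 / (2 - α) + 1 / α)) := by
  obtain ⟨hα0, hα2⟩ := hα
  obtain ⟨hρ0, hρ1⟩ := hρ
  rw [← Ioc_union_Ioc_eq_Ioc hρ0.le hρ1]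
  refine (lintegral_union_le _ _ _).trans ?_
  have h1 : ∫⁻ t in Ioc (0 : ℝ) ρ, ENNReal.ofReal (min (t ^ 2 / ρ ^ 2) 1 * t ^ (-1 - α))
      ≤ ENNReal.ofReal (ρ ^ (-α) * (1 / (2 - α))) := by
    calc _ ≤ ∫⁻ t in Ioc (0 : ℝ) ρ,
          ENNReal.ofReal (1 / ρ ^ 2) * ENNReal.ofReal (t ^ (1 - α)) := by
          refine setLIntegral_mono (by fun_prop) fun t ht => ?_
          rw [← ENNReal.ofReal_mul (by positivity)]
          refine ENNReal.ofReal_le_ofReal ?_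
          have e : t ^ (1 - α) = t ^ 2 * t ^ (-1 - α) := by
            rw [← Real.rpow_natCast, ← Real.rpow_add ht.1]; norm_num; ring_nf
          rw [e, ← mul_assoc, one_div_mul_eq_div]
          exact mul_le_mul_of_nonneg_right (min_le_left _ _) (Real.rpow_nonneg ht.1.le _)
      _ = _ := by
          rw [lintegral_const_mul _ (by fun_prop), lintegral_rpow_Ioc hρ0.le
            (Or.inl (by linarith)) le_rfl, ← ENNReal.ofReal_mul (by positivity)]
          congr 1
          rw [Real.zero_rpow (by linarith)]
          have e : ρ ^ (1 - α + 1) = ρ ^ 2 * ρ ^ (-α) := by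
            rw [← Real.rpow_natCast, ← Real.rpow_add hρ0]; norm_num; ring_nf
          rw [e]
          have : 2 - α ≠ 0 := by linarith
          have : 1 - α + 1 ≠ 0 := by linarith
          field_simp
          ring
  have h2 : ∫⁻ t in Ioc ρ 1, ENNReal.ofReal (min (t ^ 2 / ρ ^ 2) 1 * t ^ (-1 - α))
      ≤ ENNReal.ofReal (ρ ^ (-α) * (1 / α)) := by
    calc _ ≤ ∫⁻ t in Ioc ρ 1, ENNReal.ofReal (t ^ (-1 - α)) := by
          refine setLIntegral_mono (by fun_prop) fun t ht => ENNReal.ofReal_le_ofReal ?_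
          exact mul_le_of_le_one_left (Real.rpow_nonneg (hρ0.trans ht.1).le _) (min_le_right _ _)
      _ ≤ _ := by
          rw [lintegral_rpow_Ioc hρ1 (Or.inr ⟨by linarith, ?_⟩) hρ0.le]
          · refine ENNReal.ofReal_le_ofReal ?_
            have e : -1 - α + 1 = -α := by ring
            rw [e, Real.one_rpow, div_neg, ← neg_div, mul_one_div]
            gcongr
            linarith
          · rw [uIcc_of_le hρ1]
            exact fun h => absurd h.1 (by linarith)
  refine (add_le_add h1 h2).trans ?_
  have : 0 < 2 - α := by linarith
  rw [← ENNReal.ofReal_add (by positivity) (by positivity), mul_add]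

lemma lintegral_Ioo_neg_le {g : ℝ → ℝ≥0∞} (hg : ∀ t, g (-t) = g t) (r : ℝ) :
    ∫⁻ t in Ioo (-r) r, g t ≤ 2 * ∫⁻ t in Ioc 0 r, g t := by
  have hneg : ∫⁻ t in Ico (-r) 0, g t = ∫⁻ t in Ioc 0 r, g t := by
    have := (Measure.measurePreserving_neg (volume : Measure ℝ)).setLIntegral_comp_preimage_emb
      (Homeomorph.neg ℝ).measurableEmbedding g (Ico (-r) 0)
    rw [← this]
    simp [hg]
  have hsub : Ioo (-r) r ⊆ Ico (-r) 0 ∪ ({0} ∪ Ioc 0 r) := by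
    intro t ht
    rcases lt_trichotomy t 0 with h | h | h
    · exact Or.inl ⟨ht.1.le, h⟩
    · exact Or.inr (Or.inl h)
    · exact Or.inr (Or.inr ⟨h, ht.2.le⟩)
  refine (lintegral_mono_set hsub).trans ((lintegral_union_le _ _ _).trans ?_)
  rw [hneg, two_mul]
  refine add_le_add le_rfl ((lintegral_union_le _ _ _).trans ?_)
  simp

/-! ### The truncated second moment of the thorn function, and assertion (0) -/

lemma thornFunction_nonneg {b α : ℝ} (hα : α < 2) (z : E 2) : 0 ≤ thornFunction b α z := by
  unfold thornFunction
  split_ifs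
  · exact mul_nonneg (by linarith) (Real.rpow_nonneg (norm_nonneg _) _)
  · exact le_rfl

lemma measurable_thornFunction (b α : ℝ) : Measurable (thornFunction b α) := by
  classical
  refine Measurable.ite ((measurableSet_thornSet b).inter Metric.isOpen_ball.measurableSet) ?_
    measurable_const
  fun_prop

lemma thornFunction_neg (b α : ℝ) (z : E 2) : thornFunction b α (-z) = thornFunction b α z := by
  have h : -z ∈ thornSet b ∩ Metric.ball 0 1 ↔ z ∈ thornSet b ∩ Metric.ball 0 1 := by
    rw [mem_inter_iff, mem_inter_iff, neg_mem_thornSet, mem_ball_zero_iff, mem_ball_zero_iff,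
      norm_neg]
  by_cases hz : z ∈ thornSet b ∩ Metric.ball 0 1
  · rw [thornFunction, thornFunction, if_pos hz, if_pos (h.2 hz), norm_neg]
  · rw [thornFunction, thornFunction, if_neg hz, if_neg (fun h' => hz (h.1 h'))]

/-- On each thorn inside the unit ball the norm is comparable to the long coordinate `t`, because
`|s| ≤ |t|^(1/b) ≤ |t|`. The bound depends on the short coordinate `s` only through its range, which
makes the integral over slices explicit. -/
lemma thornFunction_le_sum {b α ρ : ℝ} (hb : b ∈ Ioo (0 : ℝ) 1) (hα : α ∈ Ioo (0 : ℝ) 2)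
    (z : E 2) {g : ℝ → ℝ → ℝ}
    (hg : ∀ s t, g s t = if |s| ≤ |t| ^ (1 / b) ∧ |t| < 1 then
      (2 - α) * (2 * min (t ^ 2 / ρ ^ 2) 1) * |t| ^ (-2 - (α - 1 + 1 / b)) else 0) :
    min (‖z‖ ^ 2 / ρ ^ 2) 1 * thornFunction b α z ≤ g (z 0) (z 1) + g (z 1) (z 0) := by
  obtain ⟨hb0, hb1⟩ := hb
  obtain ⟨hα0, hα2⟩ := hα
  have h1b : 1 < 1 / b := by rw [lt_div_iff₀ hb0]; linarith
  have hg0 : ∀ s t, 0 ≤ g s t := by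
    intro s t
    rw [hg]
    split_ifs
    · have : 0 < 2 - α := by linarith
      positivity
    · exact le_rfl
  have aux : ∀ i j : Fin 2, i ≠ j → z ∈ Metric.ball (0 : E 2) 1 → |z i| ^ b ≤ |z j| →
      min (‖z‖ ^ 2 / ρ ^ 2) 1 * thornFunction b α z ≤ g (z i) (z j) := by
    intro i j hij hz h
    have hle := abs_le_rpow_of_rpow_le hb0 h
    have hj : |z j| < 1 := (abs_coord_le_norm z j).trans_lt (mem_ball_zero_iff.1 hz)
    have hij' : |z i| ≤ |z j| :=
      hle.trans (Real.rpow_le_self_of_le_one (abs_nonneg _) hj.le h1b.le)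
    rw [hg, if_pos ⟨hle, hj⟩, thornFunction, if_pos ⟨mem_thornSet_of hij h, hz⟩]
    -- The origin belongs to the thorn set. There both negative powers are zero by the convention
    -- for `rpow`.
    rcases (abs_nonneg (z j)).eq_or_lt with h0 | h0
    · have hi0 : |z i| = 0 := le_antisymm (h0 ▸ hij') (abs_nonneg _)
      have : ‖z‖ = 0 := le_antisymm ((norm_le_add_abs z hij).trans (by linarith)) (norm_nonneg _)
      rw [this, Real.zero_rpow (by linarith), ← h0, Real.zero_rpow (by linarith)]
      simp
    · have hsq : ‖z‖ ^ 2 ≤ 2 * z j ^ 2 := by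
        rw [norm_sq_eq z hij]
        nlinarith [sq_le_sq.2 hij']
      have hmin : min (‖z‖ ^ 2 / ρ ^ 2) 1 ≤ 2 * min (z j ^ 2 / ρ ^ 2) 1 := by
        rw [mul_min_of_nonneg _ _ zero_le_two]
        refine min_le_min ?_ (by norm_num)
        rw [← mul_div_assoc]
        gcongr
      have hpow : ‖z‖ ^ (-2 - (α - 1 + 1 / b)) ≤ |z j| ^ (-2 - (α - 1 + 1 / b)) :=
        Real.rpow_le_rpow_of_nonpos h0 (abs_coord_le_norm z j) (by linarith)
      calc _ ≤ (2 * min (z j ^ 2 / ρ ^ 2) 1) *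
            ((2 - α) * |z j| ^ (-2 - (α - 1 + 1 / b))) := by
            have : 0 < 2 - α := by linarith
            gcongr
        _ = _ := by ring
  by_cases hz : z ∈ thornSet b ∩ Metric.ball 0 1
  · obtain ⟨h | h, hz⟩ := hz
    · exact (aux 0 1 (by decide) hz h).trans (le_add_of_nonneg_right (hg0 _ _))
    · exact (aux 1 0 (by decide) hz h).trans (le_add_of_nonneg_left (hg0 _ _))
  · rw [thornFunction, if_neg hz, mul_zero]
    exact add_nonneg (hg0 _ _) (hg0 _ _)

/-- The slice at height `t` has length `2|t|^(1/b)`, which turns `|t|^(-2-β)` into `|t|^(-1-α)` and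
leaves a one-dimensional integral. -/
lemma lintegral_thorn_slices_le {b α ρ : ℝ} (hα : α ∈ Ioo (0 : ℝ) 2)
    (hρ : ρ ∈ Ioc (0 : ℝ) 1) {g : ℝ → ℝ → ℝ}
    (hg : ∀ s t, g s t = if |s| ≤ |t| ^ (1 / b) ∧ |t| < 1 then
      (2 - α) * (2 * min (t ^ 2 / ρ ^ 2) 1) * |t| ^ (-2 - (α - 1 + 1 / b)) else 0) :
    ∫⁻ t, ∫⁻ s, ENNReal.ofReal (g s t) ≤ ENNReal.ofReal (8 * (1 + 2 / α) * ρ ^ (-α)) := by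
  obtain ⟨hα0, hα2⟩ := hα
  have h2α : 0 < 2 - α := by linarith
  have hρ0 := hρ.1
  set H : ℝ → ℝ≥0∞ := fun t =>
    ENNReal.ofReal ((2 - α) * 4) * ENNReal.ofReal (min (t ^ 2 / ρ ^ 2) 1 * |t| ^ (-1 - α)) with hH
  have inner : ∀ t, ∫⁻ s, ENNReal.ofReal (g s t) ≤ (Ioo (-1 : ℝ) 1).indicator H t := by
    intro t
    by_cases ht : |t| < 1
    · rw [indicator_of_mem (show t ∈ Ioo (-1 : ℝ) 1 from abs_lt.1 ht)]
      set c := (2 - α) * (2 * min (t ^ 2 / ρ ^ 2) 1) * |t| ^ (-2 - (α - 1 + 1 / b)) with hc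
      have hc0 : 0 ≤ c := by positivity
      have e : ∀ s, ENNReal.ofReal (g s t) =
          (Icc (-|t| ^ (1 / b)) (|t| ^ (1 / b))).indicator (fun _ => ENNReal.ofReal c) s := by
        intro s
        rw [hg]
        by_cases hs : |s| ≤ |t| ^ (1 / b)
        · rw [if_pos ⟨hs, ht⟩, indicator_of_mem (show s ∈ Icc _ _ from abs_le.1 hs)]
        · rw [if_neg (fun h => hs h.1), indicator_of_notMem (fun h : s ∈ Icc _ _ => hs (abs_le.2 h)),
            ENNReal.ofReal_zero]
      simp_rw [e]
      rw [lintegral_indicator_const measurableSet_Icc, Real.volume_Icc,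
        ← ENNReal.ofReal_mul hc0, hH]
      simp only
      rw [← ENNReal.ofReal_mul (by positivity)]
      refine ENNReal.ofReal_le_ofReal ?_
      rcases (abs_nonneg t).eq_or_lt with h0 | h0
      · have ht0 : t = 0 := abs_eq_zero.1 h0.symm
        have : (0 : ℝ) ^ 2 / ρ ^ 2 = 0 := by simp
        rw [hc, ht0, this]
        simp
      · have e : |t| ^ (-1 - α) = |t| ^ (-2 - (α - 1 + 1 / b)) * |t| ^ (1 / b) := by
          rw [← Real.rpow_add h0]; congr 1; ring
        rw [hc, e]
        exact le_of_eq (by ring)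
    · have e : ∀ s, ENNReal.ofReal (g s t) = 0 := by
        intro s
        rw [hg, if_neg (fun h => ht h.2), ENNReal.ofReal_zero]
      simp [e]
  refine (lintegral_mono inner).trans ?_
  rw [lintegral_indicator measurableSet_Ioo]
  refine (lintegral_Ioo_neg_le (by simp [hH]) 1).trans ?_
  rw [hH, lintegral_const_mul' _ _ ENNReal.ofReal_ne_top]
  have e : ∫⁻ t in Ioc (0 : ℝ) 1, ENNReal.ofReal (min (t ^ 2 / ρ ^ 2) 1 * |t| ^ (-1 - α))
      = ∫⁻ t in Ioc (0 : ℝ) 1, ENNReal.ofReal (min (t ^ 2 / ρ ^ 2) 1 * t ^ (-1 - α)) :=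
    setLIntegral_congr_fun measurableSet_Ioc fun t ht => by simp only [abs_of_pos ht.1]
  rw [e]
  refine (mul_le_mul_right (mul_le_mul_right (lintegral_min_rpow_le ⟨hα0, hα2⟩ hρ) _) _).trans ?_
  rw [← ENNReal.ofReal_mul (by positivity), ← ENNReal.ofReal_ofNat 2,
    ← ENNReal.ofReal_mul (by norm_num)]
  refine ENNReal.ofReal_le_ofReal ?_
  have hp : 0 < ρ ^ (-α) := by positivity
  -- The factor `2 - α` absorbs the singularity of the integral at `α = 2`, so the bound stays
  -- uniform there.
  have e2 : (2 - α) * (1 / (2 - α) + 1 / α) = 1 + 2 / α - 1 := by field_simp; ring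
  calc _ = 8 * ((2 - α) * (1 / (2 - α) + 1 / α)) * ρ ^ (-α) := by ring
    _ ≤ _ := by rw [e2]; gcongr; linarith

lemma lintegral_min_mul_thornFunction_le {b α ρ : ℝ} (hb : b ∈ Ioo (0 : ℝ) 1)
    (hα : α ∈ Ioo (0 : ℝ) 2) (hρ : ρ ∈ Ioc (0 : ℝ) 1) :
    ∫⁻ z : E 2, ENNReal.ofReal (min (‖z‖ ^ 2 / ρ ^ 2) 1 * thornFunction b α z)
      ≤ ENNReal.ofReal (16 * (1 + 2 / α) * ρ ^ (-α)) := by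
  classical
  set g : ℝ → ℝ → ℝ := fun s t => if |s| ≤ |t| ^ (1 / b) ∧ |t| < 1 then
      (2 - α) * (2 * min (t ^ 2 / ρ ^ 2) 1) * |t| ^ (-2 - (α - 1 + 1 / b)) else 0 with hg
  have hmeas : Measurable fun p : ℝ × ℝ => ENNReal.ofReal (g p.2 p.1) := by
    refine ENNReal.measurable_ofReal.comp (Measurable.ite ?_ (by fun_prop) measurable_const)
    have h1 : Measurable fun p : ℝ × ℝ => |p.2| := by fun_prop
    have h2 : Measurable fun p : ℝ × ℝ => |p.1| := by fun_prop
    exact (measurableSet_le h1 (h2.pow_const _)).inter (measurableSet_lt h2 measurable_const)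
  have hslice := lintegral_thorn_slices_le (b := b) hα hρ (g := g) fun s t => rfl
  have h1 : ∫⁻ z : E 2, ENNReal.ofReal (g (z 0) (z 1)) ≤
      ENNReal.ofReal (8 * (1 + 2 / α) * ρ ^ (-α)) := by
    have := measurePreserving_coords_swap.lintegral_comp hmeas
    simp only at this
    rw [this, Measure.volume_eq_prod, lintegral_prod _ hmeas.aemeasurable]
    exact hslice
  have h2 : ∫⁻ z : E 2, ENNReal.ofReal (g (z 1) (z 0)) ≤
      ENNReal.ofReal (8 * (1 + 2 / α) * ρ ^ (-α)) := by
    have := measurePreserving_coords.lintegral_comp hmeas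
    simp only at this
    rw [this, Measure.volume_eq_prod, lintegral_prod _ hmeas.aemeasurable]
    exact hslice
  calc _ ≤ ∫⁻ z : E 2, (ENNReal.ofReal (g (z 0) (z 1)) + ENNReal.ofReal (g (z 1) (z 0))) :=
        lintegral_mono fun z => (ENNReal.ofReal_le_ofReal
          (thornFunction_le_sum hb hα z fun s t => rfl)).trans ENNReal.ofReal_add_le
    _ ≤ _ := by
        rw [lintegral_add_left]
        · refine (add_le_add h1 h2).trans ?_
          have := hα.1
          have := hρ.1
          rw [← ENNReal.ofReal_add (by positivity) (by positivity)]
          exact ENNReal.ofReal_le_ofReal (by linarith)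
        · exact hmeas.comp (measurePreserving_coords_swap.measurable)

lemma isAdmissible_thornKernel {b α : ℝ} (hb : b ∈ Ioo (0 : ℝ) 1) (hα : α ∈ Ioo (0 : ℝ) 2) :
    IsAdmissible (thornKernel b α) := by
  have hm := measurable_thornFunction b α
  have h0 : ∀ z, 0 ≤ thornFunction b α z := thornFunction_nonneg hα.2
  refine ⟨fun x y => h0 _, hm.comp measurable_sub, fun x y => ?_, thornFunction b α,
    thornFunction b α, hm, hm, ⟨h0, ae_of_all _ (thornFunction_neg b α), ae_of_all _ fun _ => le_rfl⟩,
    ⟨h0, ae_of_all _ (thornFunction_neg b α), ae_of_all _ fun _ => le_rfl⟩, ?_, ?_⟩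
  · rw [thornKernel, thornKernel, ← thornFunction_neg, neg_sub]
  -- The strict inequality makes this part of the thorn open, and a nonempty open set has positive
  -- measure.
  · set V : Set (E 2) := {z | |z 0| ^ b < |z 1|} ∩ Metric.ball 0 1
    have hopen : IsOpen V := by
      refine IsOpen.inter (isOpen_lt ?_ (by fun_prop)) Metric.isOpen_ball
      exact (show Continuous fun z : E 2 => |z 0| by fun_prop).rpow_const fun _ => Or.inr hb.1.le
    have hne : V.Nonempty := by
      refine ⟨EuclideanSpace.single 1 (1 / 2), ?_, ?_⟩
      · simp [Real.zero_rpow hb.1.ne']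
      · rw [mem_ball_zero_iff, PiLp.norm_single]
        norm_num
    refine (hopen.measure_pos volume hne).trans_le (measure_mono ?_)
    rintro z ⟨hz, hz1⟩
    have hz0 : 0 < ‖z‖ := by
      refine lt_of_lt_of_le ?_ (abs_coord_le_norm z 1)
      exact (Real.rpow_nonneg (abs_nonneg _) _).trans_lt hz
    rw [mem_ofPred_eq, thornFunction, if_pos ⟨Or.inl (le_of_lt hz), hz1⟩]
    exact mul_ne_zero (by linarith [hα.2]) (Real.rpow_pos_of_pos hz0 _).ne'
  · have := lintegral_min_mul_thornFunction_le hb hα (ρ := 1) ⟨one_pos, le_rfl⟩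
    simp only [one_pow, div_one] at this
    exact this.trans_lt ENNReal.ofReal_lt_top

/-! ### Cut-off functions and condition (B) -/

/-- The transition function factors through the projection onto `[0,1]`, which is 1-Lipschitz, and a
`C¹` function is Lipschitz on that compact interval. Taking the constant at least 1 lets it also
dominate the trivial bound on increments in (B). -/
lemma exists_lipschitz_smoothTransition :
    ∃ C : ℝ, 1 ≤ C ∧ ∀ s t, |Real.smoothTransition s - Real.smoothTransition t| ≤ C * |s - t| := by
  obtain ⟨K, hK⟩ := (Real.smoothTransition.contDiff (n := 1)).contDiffOn.exists_lipschitzOnWith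
    (s := Icc (0 : ℝ) 1) one_ne_zero (convex_Icc 0 1) isCompact_Icc
  refine ⟨max 1 K, le_max_left _ _, fun s t => ?_⟩
  have h := hK.dist_le_mul _ (projIcc (0 : ℝ) 1 zero_le_one s).2 _
    (projIcc (0 : ℝ) 1 zero_le_one t).2
  rw [Real.smoothTransition.projIcc, Real.smoothTransition.projIcc, Real.dist_eq] at h
  refine h.trans (mul_le_mul (le_max_right _ _) ?_ dist_nonneg (by positivity))
  have := (LipschitzWith.projIcc (zero_le_one : (0 : ℝ) ≤ 1)).dist_le_mul s t
  simpa [Subtype.dist_eq, Real.dist_eq] using this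

/-- A radial cut-off function, equal to one on `B_R` and supported in the closure of
`B_{R + ρ}`. -/
noncomputable def radialCutoff {d : ℕ} (R ρ : ℝ) (x : E d) : ℝ :=
  Real.smoothTransition ((R + ρ - ‖x‖) / ρ)

lemma radialCutoff_eq_one {d : ℕ} {R ρ : ℝ} (hρ : 0 < ρ) {x : E d} (hx : ‖x‖ ≤ R) :
    radialCutoff R ρ x = 1 :=
  Real.smoothTransition.one_of_one_le (by rw [le_div_iff₀ hρ]; linarith)

lemma contDiff_radialCutoff {d : ℕ} {R ρ : ℝ} (hR : 0 < R) (hρ : 0 < ρ) :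
    ContDiff ℝ ∞ (radialCutoff R ρ : E d → ℝ) := by
  rw [contDiff_iff_contDiffAt]
  intro x
  -- The norm is not smooth at the origin, but the cut-off is constant there.
  by_cases hx : x = 0
  · have : radialCutoff R ρ =ᶠ[nhds x] fun _ : E d => (1 : ℝ) := by
      filter_upwards [Metric.ball_mem_nhds x hR] with y hy
      rw [hx, mem_ball_zero_iff] at hy
      exact radialCutoff_eq_one hρ hy.le
    exact contDiffAt_const.congr_of_eventuallyEq this
  · exact Real.smoothTransition.contDiffAt.comp x
      ((contDiffAt_const.sub (contDiffAt_norm ℝ hx)).div_const ρ)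

lemma tsupport_radialCutoff {d : ℕ} {R ρ : ℝ} (hρ : 0 < ρ) :
    tsupport (radialCutoff R ρ : E d → ℝ) = closure (Metric.ball 0 (R + ρ)) := by
  have : Function.support (radialCutoff R ρ : E d → ℝ) = Metric.ball 0 (R + ρ) := by
    ext x
    rw [Function.mem_support, mem_ball_zero_iff, radialCutoff, Ne,
      Real.smoothTransition.zero_iff_nonpos, not_le, div_pos_iff_of_pos_right hρ, sub_pos]
  rw [tsupport, this]

lemma condB_thornKernel {b α₀ : ℝ} (hb : b ∈ Ioo (0 : ℝ) 1) (hα₀ : α₀ ∈ Ioo (0 : ℝ) 2) :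
    CondB α₀ (thornKernel b) := by
  obtain ⟨C, hC1, hC⟩ := exists_lipschitz_smoothTransition
  have hα₀' := hα₀.1
  refine ⟨C ^ 2 * (16 * (1 + 2 / α₀)), by positivity, fun R hR ρ hρ => ⟨radialCutoff R ρ,
    contDiff_radialCutoff hR.1 hρ.1, fun x => Real.smoothTransition.nonneg _,
    tsupport_radialCutoff hρ.1,
    fun x hx => radialCutoff_eq_one hρ.1 (mem_ball_zero_iff.1 hx).le, fun α hα => ?_⟩⟩
  have hα' : α ∈ Ioo (0 : ℝ) 2 := ⟨hα₀.1.trans hα.1, hα.2⟩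
  have hρ0 := hρ.1
  refine essSup_le_of_ae_le _ (ae_of_all _ fun x => ?_)
  -- The Lipschitz bound at scale `ρ` and the bound by 1 combine into the truncated quadratic weight
  -- already integrated against the thorn function. The bound holds for every `x`, so the essential
  -- supremum costs nothing.
  have hpt : ∀ y : E 2, (radialCutoff R ρ y - radialCutoff R ρ x) ^ 2
      ≤ C ^ 2 * min (‖x - y‖ ^ 2 / ρ ^ 2) 1 := by
    intro y
    rw [mul_min_of_nonneg _ _ (by positivity)]
    refine le_min ?_ ?_
    · have h1 := hC ((R + ρ - ‖y‖) / ρ) ((R + ρ - ‖x‖) / ρ)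
      have h2 : |(R + ρ - ‖y‖) / ρ - (R + ρ - ‖x‖) / ρ| ≤ ‖x - y‖ / ρ := by
        rw [← sub_div, abs_div, abs_of_pos hρ0]
        gcongr
        have := abs_norm_sub_norm_le x y
        rwa [show R + ρ - ‖y‖ - (R + ρ - ‖x‖) = ‖x‖ - ‖y‖ by ring]
      have h3 : |radialCutoff R ρ y - radialCutoff R ρ x| ≤ C * (‖x - y‖ / ρ) :=
        h1.trans (by gcongr)
      rw [← sq_abs, ← div_pow, ← mul_pow]
      gcongr
    · have h1 := Real.smoothTransition.nonneg ((R + ρ - ‖y‖) / ρ)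
      have h2 := Real.smoothTransition.nonneg ((R + ρ - ‖x‖) / ρ)
      have h3 := Real.smoothTransition.le_one ((R + ρ - ‖y‖) / ρ)
      have h4 := Real.smoothTransition.le_one ((R + ρ - ‖x‖) / ρ)
      unfold radialCutoff
      nlinarith
  calc _ ≤ ∫⁻ y : E 2, ENNReal.ofReal (C ^ 2) *
        ENNReal.ofReal (min (‖x - y‖ ^ 2 / ρ ^ 2) 1 * thornFunction b α (x - y)) := by
        refine lintegral_mono fun y => ?_
        rw [← ENNReal.ofReal_mul (by positivity), ← mul_assoc]
        exact ENNReal.ofReal_le_ofReal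
          (mul_le_mul_of_nonneg_right (hpt y) (thornFunction_nonneg hα.2 _))
    _ = ENNReal.ofReal (C ^ 2) * ∫⁻ z : E 2,
        ENNReal.ofReal (min (‖z‖ ^ 2 / ρ ^ 2) 1 * thornFunction b α z) := by
        rw [lintegral_const_mul' _ _ ENNReal.ofReal_ne_top]
        congr 1
        exact lintegral_sub_left_eq_self
          (fun z : E 2 => ENNReal.ofReal (min (‖z‖ ^ 2 / ρ ^ 2) 1 * thornFunction b α z)) x
    _ ≤ ENNReal.ofReal (C ^ 2) * ENNReal.ofReal (16 * (1 + 2 / α) * ρ ^ (-α)) := by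
        gcongr
        exact lintegral_min_mul_thornFunction_le hb hα' ⟨hρ.1, hρ.2.le⟩
    _ ≤ _ := by
        rw [← ENNReal.ofReal_mul (by positivity)]
        refine ENNReal.ofReal_le_ofReal ?_
        have : 2 / α ≤ 2 / α₀ := div_le_div_of_nonneg_left zero_le_two hα₀' hα.1.le
        calc _ = C ^ 2 * (16 * (1 + 2 / α)) * ρ ^ (-α) := by ring
          _ ≤ _ := by gcongr

/-! ### Failure of (L1) -/

/-- By Fubini the inequality holds for almost every `y` at some fixed `x`, and `y ↦ x - y` preserves
null sets. -/
lemma ae_le_of_isLowerEnvelope {d : ℕ} {L h : E d → ℝ}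
    (hL : IsLowerEnvelope (fun x y => h (x - y)) L) : ∀ᵐ z, L z ≤ h z := by
  obtain ⟨x, hx⟩ := (Measure.ae_ae_of_ae_prod hL.2.2).exists
  have := (Measure.measurePreserving_sub_left (volume : Measure (E d)) x).quasiMeasurePreserving.ae hx
  simpa using this

lemma not_satisfiesL1From_thornKernel {b α : ℝ} (hb : b ∈ Ioo (0 : ℝ) 1)
    (hα : α ∈ Ioo (0 : ℝ) 2) (n₀ : ℕ) : ¬ SatisfiesL1From n₀ α (thornKernel b α) := by
  rintro ⟨L, hL, a, C₂, C₃, ha, hC₂, hC₃, H⟩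
  have ha0 : 0 < a := by linarith
  have hle : ∀ᵐ z, L z ≤ thornFunction b α z := ae_le_of_isLowerEnvelope hL
  set p := 1 / b - 1 with hp
  have hp0 : 0 < p := by
    have : 1 < 1 / b := by rw [lt_div_iff₀ hb.1]; linarith [hb.2]
    linarith
  -- Positivity of `L` on the ball forces almost all of the ball into the thorn set. Comparing areas
  -- and dividing by `δ²` leaves `δ^(1/b-1) = (a^(-p))^n`, which tends to zero.
  have key : ∀ n : ℕ, n₀ ≤ n → Real.pi * C₂ ^ 2 ≤ 8 * a ^ (1 + 1 / b) * (a ^ (-p)) ^ n := by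
    intro n hn
    obtain ⟨w, hw, hwL⟩ := H n hn
    set δ := a ^ (-(n : ℤ)) with hδ
    have hδ0 : 0 < δ := by positivity
    have hδa : a ^ (-(n : ℤ) + 1) = a * δ := by
      rw [zpow_add₀ ha0.ne', zpow_one, mul_comm]
    have hsub : ∀ᵐ z, z ∈ Metric.ball w (C₂ * δ) →
        z ∈ thornSet b ∩ Metric.closedBall 0 (a * δ) := by
      filter_upwards [hle] with z hz hzw
      have hz1 := hw hzw
      have hz0 : 0 < ‖z‖ := by
        have := hz1.2
        rw [mem_ball_zero_iff, not_lt] at this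
        exact hδ0.trans_le this
      refine ⟨?_, ?_⟩
      · by_contra hzΓ
        have h1 := (hwL z hzw).trans hz
        rw [thornFunction, if_neg (fun h => hzΓ h.1)] at h1
        have : 0 < 2 - α := by linarith [hα.2]
        have : 0 < C₃ * (2 - α) * ‖z‖ ^ (-((2 : ℕ) : ℝ) - α) := by positivity
        linarith
      · rw [← hδa]
        exact Metric.ball_subset_closedBall hz1.1
    have hvol := (show volume (Metric.ball w (C₂ * δ)) ≤ _ from measure_mono_ae hsub).trans
      (volume_thornSet_inter_closedBall_le hb.1 (by positivity : 0 ≤ a * δ))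
    rw [EuclideanSpace.volume_ball_fin_two, ← ENNReal.ofReal_pow (by positivity),
      ← ENNReal.ofReal_mul (by positivity),
      ENNReal.ofReal_le_ofReal_iff (by positivity), Real.mul_rpow ha0.le hδ0.le] at hvol
    have e : δ ^ (1 + 1 / b) = δ ^ 2 * (a ^ (-p)) ^ n := by
      have e1 : 1 + 1 / b = 2 + p := by rw [hp]; ring
      rw [e1, Real.rpow_add hδ0, Real.rpow_two]
      congr 1
      rw [hδ, ← Real.rpow_intCast, ← Real.rpow_natCast, ← Real.rpow_mul ha0.le,
        ← Real.rpow_mul ha0.le]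
      congr 1
      push_cast
      ring
    rw [e] at hvol
    have hδ2 : 0 < δ ^ 2 := by positivity
    refine le_of_mul_le_mul_right ?_ hδ2
    linarith
  have hlt : a ^ (-p) < 1 := Real.rpow_lt_one_of_one_lt_of_neg ha (by linarith)
  have hlim := ((tendsto_pow_atTop_nhds_zero_of_lt_one (by positivity) hlt).const_mul
    (8 * a ^ (1 + 1 / b)))
  rw [mul_zero] at hlim
  have := ge_of_tendsto hlim (Filter.eventually_atTop.2 ⟨n₀, key⟩)
  have hpi : 0 < Real.pi * C₂ ^ 2 := by positivity
  linarith

/-! ### Comparison of quadratic forms by chaining -/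

/-- The squared increment `(u(y) - u(x))²` with values in `[0,∞]`. -/
noncomputable def sqDiff {α : Type*} (u : α → ℝ) (x y : α) : ℝ≥0∞ :=
  ENNReal.ofReal ((u y - u x) ^ 2)

lemma sqDiff_self {α : Type*} (u : α → ℝ) (x : α) : sqDiff u x x = 0 := by simp [sqDiff]

lemma sqDiff_le_two {α : Type*} (u : α → ℝ) (x v y : α) :
    sqDiff u x y ≤ 2 * (sqDiff u x v + sqDiff u v y) := by
  rw [sqDiff, sqDiff, sqDiff, ← ENNReal.ofReal_add (sq_nonneg _) (sq_nonneg _),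
    ← ENNReal.ofReal_ofNat 2, ← ENNReal.ofReal_mul zero_le_two]
  refine ENNReal.ofReal_le_ofReal ?_
  nlinarith [sq_nonneg (u v - u x - (u y - u v))]

lemma sqDiff_le_three {α : Type*} (u : α → ℝ) (x v w y : α) :
    sqDiff u x y ≤ 3 * (sqDiff u x v + sqDiff u v w + sqDiff u w y) := by
  rw [sqDiff, sqDiff, sqDiff, sqDiff, ← ENNReal.ofReal_add (sq_nonneg _) (sq_nonneg _),
    ← ENNReal.ofReal_add (by positivity) (sq_nonneg _),
    ← ENNReal.ofReal_ofNat 3, ← ENNReal.ofReal_mul (by norm_num)]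
  refine ENNReal.ofReal_le_ofReal ?_
  nlinarith [sq_nonneg (u v - u x - (u y - u w)), sq_nonneg (u v - u x - (u w - u v)),
    sq_nonneg (u w - u v - (u y - u w))]

lemma measurable_sqDiff {α : Type*} [MeasurableSpace α] {u : α → ℝ} (hu : Measurable u) :
    Measurable fun p : α × α => sqDiff u p.1 p.2 := by
  unfold sqDiff
  fun_prop

/-- Marginal bounds are needed only off the diagonal, since the squared increment vanishes on it. -/
lemma lintegral_sqDiff_mul_le {α : Type*} [MeasurableSpace α] {μ : Measure α} {u : α → ℝ}
    {V : α → α → α → ℝ≥0∞} {K : α → α → ℝ≥0∞}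
    (hV : Measurable fun p : α × α × α => V p.1 p.2.1 p.2.2)
    (h : ∀ x y, x ≠ y → ∫⁻ v, V x y v ∂μ ≤ K x y) :
    ∫⁻ x, ∫⁻ y, ∫⁻ v, sqDiff u x y * V x y v ∂μ ∂μ ∂μ ≤
      ∫⁻ x, ∫⁻ y, sqDiff u x y * K x y ∂μ ∂μ := by
  refine lintegral_mono fun x => lintegral_mono fun y => ?_
  have hm : Measurable fun v => V x y v :=
    hV.comp (measurable_const.prodMk (measurable_const.prodMk measurable_id))
  simp only
  rw [lintegral_const_mul _ hm]
  rcases eq_or_ne x y with rfl | hxy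
  · simp [sqDiff_self]
  · gcongr
    exact h x y hxy

section Chains

variable {α : Type*} [MeasurableSpace α] {μ : Measure α} [SFinite μ]

lemma lintegral_swap_first {F : α → α → α → ℝ≥0∞}
    (hF : Measurable fun p : α × α × α => F p.1 p.2.1 p.2.2) :
    ∫⁻ a, ∫⁻ b, ∫⁻ c, F a b c ∂μ ∂μ ∂μ = ∫⁻ b, ∫⁻ a, ∫⁻ c, F a b c ∂μ ∂μ ∂μ := by
  have h : Measurable fun p : (α × α) × α => F p.1.1 p.1.2 p.2 :=
    hF.comp (measurable_fst.fst.prodMk (measurable_fst.snd.prodMk measurable_snd))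
  exact lintegral_lintegral_swap (f := fun a b => ∫⁻ c, F a b c ∂μ)
    h.lintegral_prod_right'.aemeasurable

lemma lintegral_swap_last {F : α → α → α → ℝ≥0∞}
    (hF : Measurable fun p : α × α × α => F p.1 p.2.1 p.2.2) :
    ∫⁻ a, ∫⁻ b, ∫⁻ c, F a b c ∂μ ∂μ ∂μ = ∫⁻ a, ∫⁻ c, ∫⁻ b, F a b c ∂μ ∂μ ∂μ :=
  lintegral_congr fun a => lintegral_lintegral_swap (f := fun b c => F a b c)
    (hF.comp (measurable_prodMk_left (x := a))).aemeasurable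

lemma lintegral_add_triple {F : α → α → α → ℝ≥0∞}
    (hF : Measurable fun p : α × α × α => F p.1 p.2.1 p.2.2) (G : α → α → α → ℝ≥0∞) :
    ∫⁻ a, ∫⁻ b, ∫⁻ c, (F a b c + G a b c) ∂μ ∂μ ∂μ =
      ∫⁻ a, ∫⁻ b, ∫⁻ c, F a b c ∂μ ∂μ ∂μ + ∫⁻ a, ∫⁻ b, ∫⁻ c, G a b c ∂μ ∂μ ∂μ := by
  have h : Measurable fun p : (α × α) × α => F p.1.1 p.1.2 p.2 :=
    hF.comp (measurable_fst.fst.prodMk (measurable_fst.snd.prodMk measurable_snd))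
  have h' := h.lintegral_prod_right' (ν := μ)
  rw [← lintegral_add_left (f := fun a => ∫⁻ b, ∫⁻ c, F a b c ∂μ ∂μ) h'.lintegral_prod_right']
  refine lintegral_congr fun a => ?_
  rw [← lintegral_add_left (f := fun b => ∫⁻ c, F a b c ∂μ)
    (h'.comp (measurable_prodMk_left (x := a)))]
  refine lintegral_congr fun b => ?_
  rw [← lintegral_add_left (f := fun c => F a b c) (h.comp (measurable_prodMk_left (x := (a, b))))]

lemma lintegral_swap_first_four {F : α → α → α → α → ℝ≥0∞}
    (hF : Measurable fun p : α × α × α × α => F p.1 p.2.1 p.2.2.1 p.2.2.2) :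
    ∫⁻ a, ∫⁻ b, ∫⁻ c, ∫⁻ d, F a b c d ∂μ ∂μ ∂μ ∂μ =
      ∫⁻ b, ∫⁻ a, ∫⁻ c, ∫⁻ d, F a b c d ∂μ ∂μ ∂μ ∂μ := by
  have h : Measurable fun p : (α × α × α) × α => F p.1.1 p.1.2.1 p.1.2.2 p.2 :=
    hF.comp (measurable_fst.fst.prodMk
      (measurable_fst.snd.fst.prodMk (measurable_fst.snd.snd.prodMk measurable_snd)))
  exact lintegral_swap_first (F := fun a b c => ∫⁻ d, F a b c d ∂μ) h.lintegral_prod_right'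

lemma lintegral_swap_middle_four {F : α → α → α → α → ℝ≥0∞}
    (hF : Measurable fun p : α × α × α × α => F p.1 p.2.1 p.2.2.1 p.2.2.2) :
    ∫⁻ a, ∫⁻ b, ∫⁻ c, ∫⁻ d, F a b c d ∂μ ∂μ ∂μ ∂μ =
      ∫⁻ a, ∫⁻ c, ∫⁻ b, ∫⁻ d, F a b c d ∂μ ∂μ ∂μ ∂μ :=
  lintegral_congr fun a => lintegral_swap_first (F := fun b c d => F a b c d)
    (hF.comp (measurable_prodMk_left (x := a)))

lemma lintegral_swap_last_four {F : α → α → α → α → ℝ≥0∞}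
    (hF : Measurable fun p : α × α × α × α => F p.1 p.2.1 p.2.2.1 p.2.2.2) :
    ∫⁻ a, ∫⁻ b, ∫⁻ c, ∫⁻ d, F a b c d ∂μ ∂μ ∂μ ∂μ =
      ∫⁻ a, ∫⁻ b, ∫⁻ d, ∫⁻ c, F a b c d ∂μ ∂μ ∂μ ∂μ :=
  lintegral_congr fun a => lintegral_swap_last (F := fun b c d => F a b c d)
    (hF.comp (measurable_prodMk_left (x := a)))

lemma lintegral_add_quadruple {F : α → α → α → α → ℝ≥0∞}
    (hF : Measurable fun p : α × α × α × α => F p.1 p.2.1 p.2.2.1 p.2.2.2)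
    (G : α → α → α → α → ℝ≥0∞) :
    ∫⁻ a, ∫⁻ b, ∫⁻ c, ∫⁻ d, (F a b c d + G a b c d) ∂μ ∂μ ∂μ ∂μ =
      ∫⁻ a, ∫⁻ b, ∫⁻ c, ∫⁻ d, F a b c d ∂μ ∂μ ∂μ ∂μ +
        ∫⁻ a, ∫⁻ b, ∫⁻ c, ∫⁻ d, G a b c d ∂μ ∂μ ∂μ ∂μ := by
  have h : Measurable fun p : (α × α × α) × α => F p.1.1 p.1.2.1 p.1.2.2 p.2 :=
    hF.comp (measurable_fst.fst.prodMk
      (measurable_fst.snd.fst.prodMk (measurable_fst.snd.snd.prodMk measurable_snd)))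
  rw [← lintegral_add_triple (F := fun a b c => ∫⁻ d, F a b c d ∂μ) h.lintegral_prod_right']
  refine lintegral_congr fun a => lintegral_congr fun b => lintegral_congr fun c => ?_
  rw [← lintegral_add_left (f := fun d => F a b c d)
    (h.comp (measurable_prodMk_left (x := (a, b, c))))]

/-- Comparison of quadratic forms through one intermediate point. -/
lemma lintegral_sqDiff_le_of_chain_two {u : α → ℝ} (hu : Measurable u) {W : α → α → α → ℝ≥0∞}
    (hW : Measurable fun p : α × α × α => W p.1 p.2.1 p.2.2) {K K₁ K₂ : α → α → ℝ≥0∞}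
    (hK : ∀ᵐ x ∂μ, ∀ᵐ y ∂μ, K x y ≤ ∫⁻ v, W x v y ∂μ)
    (hK₁ : ∀ x v, x ≠ v → ∫⁻ y, W x v y ∂μ ≤ K₁ x v)
    (hK₂ : ∀ v y, v ≠ y → ∫⁻ x, W x v y ∂μ ≤ K₂ v y) :
    ∫⁻ x, ∫⁻ y, sqDiff u x y * K x y ∂μ ∂μ ≤
      2 * (∫⁻ x, ∫⁻ y, sqDiff u x y * K₁ x y ∂μ ∂μ +
        ∫⁻ x, ∫⁻ y, sqDiff u x y * K₂ x y ∂μ ∂μ) := by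
  have hf' : ∀ {g h : α × α × α → α}, Measurable g → Measurable h →
      Measurable fun z => sqDiff u (g z) (h z) :=
    fun hg hh => (measurable_sqDiff hu).comp (hg.prodMk hh)
  have hW' : ∀ {g h k : α × α × α → α}, Measurable g → Measurable h → Measurable k →
      Measurable fun z => W (g z) (h z) (k z) :=
    fun hg hh hk => hW.comp (hg.prodMk (hh.prodMk hk))
  have q1 : Measurable fun p : α × α × α => p.1 := measurable_fst
  have q2 : Measurable fun p : α × α × α => p.2.1 := measurable_snd.fst
  have q3 : Measurable fun p : α × α × α => p.2.2 := measurable_snd.snd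
  -- Tonelli moves the endpoints of the increment to the outer integrals. The remaining variable
  -- sees only `W` and is integrated out by the marginal bound.
  have h1 : ∫⁻ x, ∫⁻ y, ∫⁻ v, sqDiff u x v * W x v y ∂μ ∂μ ∂μ ≤
      ∫⁻ x, ∫⁻ v, sqDiff u x v * K₁ x v ∂μ ∂μ :=
    (lintegral_swap_last (F := fun x y v => sqDiff u x v * W x v y)
      ((hf' q1 q3).mul (hW' q1 q3 q2))).trans_le
    (lintegral_sqDiff_mul_le (V := fun x v y => W x v y) hW hK₁)
  have h2 : ∫⁻ x, ∫⁻ y, ∫⁻ v, sqDiff u v y * W x v y ∂μ ∂μ ∂μ ≤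
      ∫⁻ v, ∫⁻ y, sqDiff u v y * K₂ v y ∂μ ∂μ :=
    (((lintegral_swap_last (F := fun x y v => sqDiff u v y * W x v y)
      ((hf' q3 q2).mul (hW' q1 q3 q2))).trans
    (lintegral_swap_first (F := fun x v y => sqDiff u v y * W x v y)
      ((hf' q2 q3).mul (hW' q1 q2 q3)))).trans
    (lintegral_swap_last (F := fun v x y => sqDiff u v y * W x v y)
      ((hf' q1 q3).mul (hW' q2 q1 q3)))).trans_le
    (lintegral_sqDiff_mul_le (V := fun v y x => W x v y) (hW' q3 q1 q2) hK₂)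
  calc ∫⁻ x, ∫⁻ y, sqDiff u x y * K x y ∂μ ∂μ
      ≤ ∫⁻ x, ∫⁻ y, 2 * ∫⁻ v, (sqDiff u x v * W x v y + sqDiff u v y * W x v y) ∂μ ∂μ ∂μ := by
        refine lintegral_mono_ae ?_
        filter_upwards [hK] with x hx
        refine lintegral_mono_ae ?_
        filter_upwards [hx] with y hxy
        have hm : Measurable fun v => W x v y :=
          hW.comp (measurable_const.prodMk (measurable_id.prodMk measurable_const))
        calc _ ≤ sqDiff u x y * ∫⁻ v, W x v y ∂μ := by gcongr
          _ = ∫⁻ v, sqDiff u x y * W x v y ∂μ := (lintegral_const_mul _ hm).symm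
          _ ≤ ∫⁻ v, 2 * (sqDiff u x v * W x v y + sqDiff u v y * W x v y) ∂μ :=
              lintegral_mono fun v => by
                simp only
                rw [← add_mul, ← mul_assoc]
                gcongr
                exact sqDiff_le_two u x v y
          _ = _ := lintegral_const_mul' _ _ (by norm_num)
    _ = 2 * (∫⁻ x, ∫⁻ y, ∫⁻ v, sqDiff u x v * W x v y ∂μ ∂μ ∂μ +
          ∫⁻ x, ∫⁻ y, ∫⁻ v, sqDiff u v y * W x v y ∂μ ∂μ ∂μ) := by
        rw [← lintegral_add_triple (F := fun x y v => sqDiff u x v * W x v y)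
          ((hf' q1 q3).mul (hW' q1 q3 q2)), ← lintegral_const_mul' _ _ (by norm_num)]
        refine lintegral_congr fun x => ?_
        rw [lintegral_const_mul' _ _ (by norm_num)]
    _ ≤ _ := by gcongr

lemma lintegral_sqDiff_mul_mul_le {u : α → ℝ} {V : α → α → α → α → ℝ≥0∞} {K : α → α → ℝ≥0∞}
    (hV : Measurable fun p : α × α × α × α => V p.1 p.2.1 p.2.2.1 p.2.2.2)
    (h : ∀ x y, x ≠ y → ∫⁻ v, ∫⁻ w, V x y v w ∂μ ∂μ ≤ K x y) :
    ∫⁻ x, ∫⁻ y, ∫⁻ v, ∫⁻ w, sqDiff u x y * V x y v w ∂μ ∂μ ∂μ ∂μ ≤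
      ∫⁻ x, ∫⁻ y, sqDiff u x y * K x y ∂μ ∂μ := by
  have hm : Measurable fun p : (α × α × α) × α => V p.1.1 p.1.2.1 p.1.2.2 p.2 :=
    hV.comp (measurable_fst.fst.prodMk
      (measurable_fst.snd.fst.prodMk (measurable_fst.snd.snd.prodMk measurable_snd)))
  have e : ∀ x y v, ∫⁻ w, sqDiff u x y * V x y v w ∂μ = sqDiff u x y * ∫⁻ w, V x y v w ∂μ :=
    fun x y v => lintegral_const_mul _ (hm.comp (measurable_prodMk_left (x := (x, y, v))))
  simp_rw [e]
  exact lintegral_sqDiff_mul_le (V := fun x y v => ∫⁻ w, V x y v w ∂μ) hm.lintegral_prod_right' h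

/-- Comparison of quadratic forms through two intermediate points. -/
lemma lintegral_sqDiff_le_of_chain_three {u : α → ℝ} (hu : Measurable u)
    {W : α → α → α → α → ℝ≥0∞}
    (hW : Measurable fun p : α × α × α × α => W p.1 p.2.1 p.2.2.1 p.2.2.2)
    {K K' : α → α → ℝ≥0∞}
    (hK : ∀ᵐ x ∂μ, ∀ᵐ y ∂μ, K x y ≤ ∫⁻ v, ∫⁻ w, W x v w y ∂μ ∂μ)
    (h₁ : ∀ x v, x ≠ v → ∫⁻ w, ∫⁻ y, W x v w y ∂μ ∂μ ≤ K' x v)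
    (h₂ : ∀ v w, v ≠ w → ∫⁻ x, ∫⁻ y, W x v w y ∂μ ∂μ ≤ K' v w)
    (h₃ : ∀ w y, w ≠ y → ∫⁻ v, ∫⁻ x, W x v w y ∂μ ∂μ ≤ K' w y) :
    ∫⁻ x, ∫⁻ y, sqDiff u x y * K x y ∂μ ∂μ ≤ 9 * ∫⁻ x, ∫⁻ y, sqDiff u x y * K' x y ∂μ ∂μ := by
  have hf' : ∀ {g h : α × α × α × α → α}, Measurable g → Measurable h →
      Measurable fun z => sqDiff u (g z) (h z) :=
    fun hg hh => (measurable_sqDiff hu).comp (hg.prodMk hh)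
  have hW' : ∀ {g h k l : α × α × α × α → α}, Measurable g → Measurable h → Measurable k →
      Measurable l → Measurable fun z => W (g z) (h z) (k z) (l z) :=
    fun hg hh hk hl => hW.comp (hg.prodMk (hh.prodMk (hk.prodMk hl)))
  have q1 : Measurable fun p : α × α × α × α => p.1 := measurable_fst
  have q2 : Measurable fun p : α × α × α × α => p.2.1 := measurable_snd.fst
  have q3 : Measurable fun p : α × α × α × α => p.2.2.1 := measurable_snd.snd.fst
  have q4 : Measurable fun p : α × α × α × α => p.2.2.2 := measurable_snd.snd.snd
  have h1 : ∫⁻ x, ∫⁻ y, ∫⁻ v, ∫⁻ w, sqDiff u x v * W x v w y ∂μ ∂μ ∂μ ∂μ ≤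
      ∫⁻ x, ∫⁻ y, sqDiff u x y * K' x y ∂μ ∂μ :=
    ((lintegral_swap_middle_four (F := fun x y v w => sqDiff u x v * W x v w y)
      ((hf' q1 q3).mul (hW' q1 q3 q4 q2))).trans
    (lintegral_swap_last_four (F := fun x v y w => sqDiff u x v * W x v w y)
      ((hf' q1 q2).mul (hW' q1 q2 q4 q3)))).trans_le
    (lintegral_sqDiff_mul_mul_le (V := fun x v w y => W x v w y) hW h₁)
  have h2 : ∫⁻ x, ∫⁻ y, ∫⁻ v, ∫⁻ w, sqDiff u v w * W x v w y ∂μ ∂μ ∂μ ∂μ ≤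
      ∫⁻ x, ∫⁻ y, sqDiff u x y * K' x y ∂μ ∂μ :=
    ((((lintegral_swap_middle_four (F := fun x y v w => sqDiff u v w * W x v w y)
      ((hf' q3 q4).mul (hW' q1 q3 q4 q2))).trans
    (lintegral_swap_first_four (F := fun x v y w => sqDiff u v w * W x v w y)
      ((hf' q2 q4).mul (hW' q1 q2 q4 q3)))).trans
    (lintegral_swap_last_four (F := fun v x y w => sqDiff u v w * W x v w y)
      ((hf' q1 q4).mul (hW' q2 q1 q4 q3)))).trans
    (lintegral_swap_middle_four (F := fun v x w y => sqDiff u v w * W x v w y)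
      ((hf' q1 q3).mul (hW' q2 q1 q3 q4)))).trans_le
    (lintegral_sqDiff_mul_mul_le (V := fun v w x y => W x v w y) (hW' q3 q1 q2 q4) h₂)
  have h3 : ∫⁻ x, ∫⁻ y, ∫⁻ v, ∫⁻ w, sqDiff u w y * W x v w y ∂μ ∂μ ∂μ ∂μ ≤
      ∫⁻ x, ∫⁻ y, sqDiff u x y * K' x y ∂μ ∂μ :=
    (((((lintegral_swap_last_four (F := fun x y v w => sqDiff u w y * W x v w y)
      ((hf' q4 q2).mul (hW' q1 q3 q4 q2))).trans
    (lintegral_swap_middle_four (F := fun x y w v => sqDiff u w y * W x v w y)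
      ((hf' q3 q2).mul (hW' q1 q4 q3 q2)))).trans
    (lintegral_swap_first_four (F := fun x w y v => sqDiff u w y * W x v w y)
      ((hf' q2 q3).mul (hW' q1 q4 q2 q3)))).trans
    (lintegral_swap_middle_four (F := fun w x y v => sqDiff u w y * W x v w y)
      ((hf' q1 q3).mul (hW' q2 q4 q1 q3)))).trans
    (lintegral_swap_last_four (F := fun w y x v => sqDiff u w y * W x v w y)
      ((hf' q1 q2).mul (hW' q3 q4 q1 q2)))).trans_le
    (lintegral_sqDiff_mul_mul_le (V := fun w y v x => W x v w y) (hW' q4 q3 q1 q2) h₃)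
  calc ∫⁻ x, ∫⁻ y, sqDiff u x y * K x y ∂μ ∂μ
      ≤ ∫⁻ x, ∫⁻ y, 3 * ∫⁻ v, ∫⁻ w, (sqDiff u x v * W x v w y +
          (sqDiff u v w * W x v w y + sqDiff u w y * W x v w y)) ∂μ ∂μ ∂μ ∂μ := by
        refine lintegral_mono_ae ?_
        filter_upwards [hK] with x hx
        refine lintegral_mono_ae ?_
        filter_upwards [hx] with y hxy
        have hm : Measurable fun p : α × α => W x p.1 p.2 y :=
          hW.comp (measurable_const.prodMk
            (measurable_fst.prodMk (measurable_snd.prodMk measurable_const)))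
        calc _ ≤ sqDiff u x y * ∫⁻ v, ∫⁻ w, W x v w y ∂μ ∂μ := by gcongr
          _ = ∫⁻ v, ∫⁻ w, sqDiff u x y * W x v w y ∂μ ∂μ := by
              rw [← lintegral_const_mul (f := fun v => ∫⁻ w, W x v w y ∂μ) _
                hm.lintegral_prod_right']
              refine lintegral_congr fun v => ?_
              exact (lintegral_const_mul _ (hm.comp (measurable_prodMk_left (x := v)))).symm
          _ ≤ ∫⁻ v, ∫⁻ w, 3 * (sqDiff u x v * W x v w y +
              (sqDiff u v w * W x v w y + sqDiff u w y * W x v w y)) ∂μ ∂μ := by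
              refine lintegral_mono fun v => lintegral_mono fun w => ?_
              simp only
              rw [← add_mul, ← add_mul, ← mul_assoc, ← add_assoc]
              gcongr
              exact sqDiff_le_three u x v w y
          _ = _ := by
              rw [← lintegral_const_mul' _ _ (by norm_num)]
              refine lintegral_congr fun v => ?_
              rw [lintegral_const_mul' _ _ (by norm_num)]
    _ = 3 * (∫⁻ x, ∫⁻ y, ∫⁻ v, ∫⁻ w, sqDiff u x v * W x v w y ∂μ ∂μ ∂μ ∂μ +
          (∫⁻ x, ∫⁻ y, ∫⁻ v, ∫⁻ w, sqDiff u v w * W x v w y ∂μ ∂μ ∂μ ∂μ +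
          ∫⁻ x, ∫⁻ y, ∫⁻ v, ∫⁻ w, sqDiff u w y * W x v w y ∂μ ∂μ ∂μ ∂μ)) := by
        rw [← lintegral_add_quadruple (F := fun x y v w => sqDiff u v w * W x v w y)
            ((hf' q3 q4).mul (hW' q1 q3 q4 q2)),
          ← lintegral_add_quadruple (F := fun x y v w => sqDiff u x v * W x v w y)
            ((hf' q1 q3).mul (hW' q1 q3 q4 q2)),
          ← lintegral_const_mul' _ _ (by norm_num)]
        refine lintegral_congr fun x => ?_
        rw [lintegral_const_mul' _ _ (by norm_num)]
    -- The 9 is 3 from the squared sum of three increments times one form for each of the three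
    -- steps.
    _ ≤ 3 * (∫⁻ x, ∫⁻ y, sqDiff u x y * K' x y ∂μ ∂μ + (∫⁻ x, ∫⁻ y, sqDiff u x y * K' x y ∂μ ∂μ +
          ∫⁻ x, ∫⁻ y, sqDiff u x y * K' x y ∂μ ∂μ)) := by gcongr
    _ = _ := by ring

end Chains

/-! ### Intermediate points near the midpoint -/

lemma volume_real_avoiding_ge (a b c : ℝ) {ℓ : ℝ} (hℓ : 0 ≤ ℓ) :
    ENNReal.ofReal (ℓ / 10) ≤
      volume {t : ℝ | |t - c| ≤ ℓ / 12 ∧ ℓ / 100 ≤ |t - a| ∧ ℓ / 100 ≤ |t - b|} := by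
  set S := {t : ℝ | |t - c| ≤ ℓ / 12 ∧ ℓ / 100 ≤ |t - a| ∧ ℓ / 100 ≤ |t - b|}
  have hsub : Icc (c - ℓ / 12) (c + ℓ / 12) ⊆
      S ∪ (Metric.ball a (ℓ / 100) ∪ Metric.ball b (ℓ / 100)) := by
    intro t ht
    by_cases ha : |t - a| < ℓ / 100
    · exact Or.inr (Or.inl ha)
    by_cases hb : |t - b| < ℓ / 100
    · exact Or.inr (Or.inr hb)
    exact Or.inl ⟨abs_le.2 ⟨by linarith [ht.1], by linarith [ht.2]⟩, not_lt.1 ha, not_lt.1 hb⟩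
  have h := (measure_mono (μ := volume) hsub).trans ((measure_union_le _ _).trans
    (add_le_add le_rfl (measure_union_le _ _)))
  rw [Real.volume_Icc, Real.volume_ball, Real.volume_ball,
    ← ENNReal.ofReal_add (by positivity) (by positivity)] at h
  rw [← tsub_le_iff_right, ← ENNReal.ofReal_sub _ (by positivity)] at h
  refine le_trans (ENNReal.ofReal_le_ofReal ?_) h
  linarith

/-- Points near the midpoint of `x` and `y` whose coordinates stay away from those of `x` and
of `y`. -/
def midSet (x y : E 2) : Set (E 2) :=
  {v | ‖v - (1 / 2 : ℝ) • (x + y)‖ ≤ ‖x - y‖ / 4 ∧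
    ∀ i, ‖x - y‖ / 100 ≤ |v i - x i| ∧ ‖x - y‖ / 100 ≤ |v i - y i|}

lemma midSet_comm (x y : E 2) : midSet x y = midSet y x := by
  ext v
  simp only [midSet, mem_ofPred_eq, add_comm x y, norm_sub_rev x y]
  exact and_congr_right fun _ => forall_congr' fun i => and_comm

lemma measurableSet_midSet : MeasurableSet {p : E 2 × E 2 × E 2 | p.2.1 ∈ midSet p.1 p.2.2} := by
  have h1 : MeasurableSet {p : E 2 × E 2 × E 2 |
      ‖p.2.1 - (1 / 2 : ℝ) • (p.1 + p.2.2)‖ ≤ ‖p.1 - p.2.2‖ / 4} :=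
    measurableSet_le (by fun_prop) (by fun_prop)
  have h2 : ∀ i : Fin 2, MeasurableSet {p : E 2 × E 2 × E 2 |
      ‖p.1 - p.2.2‖ / 100 ≤ |p.2.1 i - p.1 i| ∧ ‖p.1 - p.2.2‖ / 100 ≤ |p.2.1 i - p.2.2 i|} :=
    fun i => by
      have e1 : Measurable fun p : E 2 × E 2 × E 2 => ‖p.1 - p.2.2‖ / 100 := by fun_prop
      have e2 : Measurable fun p : E 2 × E 2 × E 2 => |p.2.1 i - p.1 i| := by fun_prop
      have e3 : Measurable fun p : E 2 × E 2 × E 2 => |p.2.1 i - p.2.2 i| := by fun_prop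
      exact (measurableSet_le e1 e2).inter (measurableSet_le e1 e3)
  convert h1.inter (MeasurableSet.iInter h2) using 1
  ext p
  simp only [midSet, mem_inter_iff, mem_iInter, mem_ofPred_eq]

/-- The midpoint is at distance `‖x-y‖/2` from `x`, and `v` is within `‖x-y‖/4` of it. The factor
`3/4 < 1` is what makes iterated splitting shorten jumps. -/
lemma norm_sub_le_of_mem_midSet {x y v : E 2} (hv : v ∈ midSet x y) :
    ‖x - v‖ ≤ 3 / 4 * ‖x - y‖ ∧ ‖x - y‖ ≤ 4 * ‖x - v‖ := by
  set m := (1 / 2 : ℝ) • (x + y) with hm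
  have h1 : ‖v - m‖ ≤ ‖x - y‖ / 4 := hv.1
  have h2 : ‖x - m‖ = ‖x - y‖ / 2 := by
    have : x - m = (1 / 2 : ℝ) • (x - y) := by rw [hm]; module
    rw [this, norm_smul]
    norm_num
    ring
  have h3 : ‖x - v‖ ≤ ‖x - m‖ + ‖v - m‖ := by
    rw [norm_sub_rev v m]; exact norm_sub_le_norm_sub_add_norm_sub x m v
  have h4 : ‖x - m‖ ≤ ‖x - v‖ + ‖v - m‖ := norm_sub_le_norm_sub_add_norm_sub x v m
  constructor <;> linarith

lemma volume_midSet_inter_ball_ge {x₀ x y : E 2} {r : ℝ} (hx : x ∈ Metric.ball x₀ r)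
    (hy : y ∈ Metric.ball x₀ r) :
    ENNReal.ofReal (‖x - y‖ ^ 2 / 100) ≤ volume (midSet x y ∩ Metric.ball x₀ r) := by
  set ℓ := ‖x - y‖ with hℓ
  rcases (norm_nonneg (x - y)).eq_or_lt with h0 | h0
  · rw [hℓ, ← h0]; simp
  rw [mem_ball_iff_norm] at hx hy
  have hr : 0 < r := (norm_nonneg _).trans_lt hx
  have hℓr : ℓ < 2 * r := by
    have := norm_sub_le_norm_sub_add_norm_sub x x₀ y
    rw [norm_sub_rev x₀ y] at this
    linarith
  set m := (1 / 2 : ℝ) • (x + y) with hm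
  have hmr : ‖m - x₀‖ < r := by
    have e : m - x₀ = (1 / 2 : ℝ) • ((x - x₀) + (y - x₀)) := by rw [hm]; module
    have := norm_add_le (x - x₀) (y - x₀)
    rw [e, norm_smul]
    norm_num
    linarith
  -- The midpoint may lie close to the boundary. Moving it towards the centre by the fraction `s`
  -- costs at most `ℓ/8` and leaves room `ℓ/8` inside the ball.
  set s := ℓ / (8 * r) with hs
  have hs0 : 0 < s := by positivity
  have hs1 : s ≤ 1 := by rw [hs, div_le_one (by positivity)]; linarith
  have hsr : s * r = ℓ / 8 := by rw [hs]; field_simp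
  set c := m + s • (x₀ - m) with hc
  have hsub : {v : E 2 | v 0 ∈ {t : ℝ | |t - c 0| ≤ ℓ / 12 ∧ ℓ / 100 ≤ |t - x 0| ∧
        ℓ / 100 ≤ |t - y 0|} ∧ v 1 ∈ {t : ℝ | |t - c 1| ≤ ℓ / 12 ∧ ℓ / 100 ≤ |t - x 1| ∧
        ℓ / 100 ≤ |t - y 1|}} ⊆ midSet x y ∩ Metric.ball x₀ r := by
    rintro v ⟨⟨h1, h2, h3⟩, h4, h5, h6⟩
    have hvc : ‖v - c‖ < ℓ / 8 := by
      -- A square of half-side `ℓ/12` fits in this room because `√2/12 < 1/8`.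
      refine lt_of_pow_lt_pow_left₀ 2 (by positivity) ?_
      rw [norm_sq_eq (v - c) (by decide : (0 : Fin 2) ≠ 1), PiLp.sub_apply, PiLp.sub_apply,
        ← sq_abs (v 0 - c 0), ← sq_abs (v 1 - c 1)]
      have := pow_le_pow_left₀ (abs_nonneg _) h1 2
      have := pow_le_pow_left₀ (abs_nonneg _) h4 2
      have : 0 < ℓ ^ 2 := by positivity
      nlinarith
    refine ⟨⟨?_, fun i => ?_⟩, ?_⟩
    · have e : v - m = (v - c) + s • (x₀ - m) := by rw [hc]; module
      have e2 : ‖s • (x₀ - m)‖ ≤ ℓ / 8 := by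
        rw [norm_smul, Real.norm_of_nonneg hs0.le, norm_sub_rev, ← hsr]
        gcongr
      change ‖v - m‖ ≤ ℓ / 4
      rw [e]
      have := norm_add_le (v - c) (s • (x₀ - m))
      linarith
    · fin_cases i
      · exact ⟨h2, h3⟩
      · exact ⟨h5, h6⟩
    · rw [mem_ball_iff_norm]
      have e : v - x₀ = (v - c) + (1 - s) • (m - x₀) := by rw [hc]; module
      have e2 : ‖(1 - s) • (m - x₀)‖ ≤ (1 - s) * r := by
        rw [norm_smul, Real.norm_of_nonneg (by linarith)]
        gcongr
      rw [e]
      have := norm_add_le (v - c) ((1 - s) • (m - x₀))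
      linarith
  refine le_trans ?_ (measure_mono hsub)
  have hmeas : ∀ i : Fin 2, MeasurableSet {t : ℝ | |t - c i| ≤ ℓ / 12 ∧ ℓ / 100 ≤ |t - x i| ∧
      ℓ / 100 ≤ |t - y i|} := fun i => by
    have e : ∀ a : ℝ, Measurable fun t : ℝ => |t - a| := fun a => by fun_prop
    exact (measurableSet_le (e _) measurable_const).inter
      ((measurableSet_le measurable_const (e _)).inter (measurableSet_le measurable_const (e _)))
  rw [volume_box (by decide) (hmeas 0) (hmeas 1)]
  refine le_trans (le_of_eq ?_) (mul_le_mul' (volume_real_avoiding_ge (x 0) (y 0) (c 0) h0.le)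
    (volume_real_avoiding_ge (x 1) (y 1) (c 1) h0.le))
  rw [← ENNReal.ofReal_mul (by positivity)]
  congr 1
  ring

/-- Comparison of translation invariant forms on a ball through points near the midpoint. -/
lemma lintegral_sqDiff_le_of_midSet {κ κ₁ : E 2 → ℝ≥0∞} (hκ : Measurable κ) (hκ0 : κ 0 = 0)
    (hκe : ∀ z, κ (-z) = κ z) (hκ₁e : ∀ z, κ₁ (-z) = κ₁ z)
    (h : ∀ x v, x ≠ v → ∫⁻ y, {y | v ∈ midSet x y}.indicator
      (fun y => κ (x - y) * ENNReal.ofReal (100 / ‖x - y‖ ^ 2)) y ≤ κ₁ (x - v))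
    (x₀ : E 2) (r : ℝ) {u : E 2 → ℝ} (hu : Measurable u) :
    ∫⁻ x in Metric.ball x₀ r, ∫⁻ y in Metric.ball x₀ r, sqDiff u x y * κ (x - y) ≤
      4 * ∫⁻ x in Metric.ball x₀ r, ∫⁻ y in Metric.ball x₀ r, sqDiff u x y * κ₁ (x - y) := by
  set B := Metric.ball x₀ r
  set W : E 2 → E 2 → E 2 → ℝ≥0∞ := fun x v y => {y | v ∈ midSet x y}.indicator
      (fun y => κ (x - y) * ENNReal.ofReal (100 / ‖x - y‖ ^ 2)) y with hW
  have hWm : Measurable fun p : E 2 × E 2 × E 2 => W p.1 p.2.1 p.2.2 := by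
    have e : (fun p : E 2 × E 2 × E 2 => W p.1 p.2.1 p.2.2) =
        {p : E 2 × E 2 × E 2 | p.2.1 ∈ midSet p.1 p.2.2}.indicator
          (fun p => κ (p.1 - p.2.2) * ENNReal.ofReal (100 / ‖p.1 - p.2.2‖ ^ 2)) := by
      ext p
      simp only [hW, indicator, mem_ofPred_eq]
    rw [e]
    exact Measurable.indicator (by fun_prop) measurableSet_midSet
  have h1 : ∀ x v, x ≠ v → ∫⁻ y in B, W x v y ≤ κ₁ (x - v) := fun x v hxv =>
    (setLIntegral_le_lintegral _ _).trans (h x v hxv)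
  have h2 : ∀ v y, v ≠ y → ∫⁻ x in B, W x v y ≤ κ₁ (v - y) := by
    intro v y hvy
    rw [← hκ₁e, neg_sub]
    refine le_trans (le_of_eq (lintegral_congr fun x => ?_)) (h1 y v hvy.symm)
    simp only [hW, indicator, mem_ofPred_eq]
    rw [← neg_sub y x, hκe, norm_neg]
    by_cases hv : v ∈ midSet x y
    · rw [if_pos hv, if_pos (midSet_comm x y ▸ hv)]
    · rw [if_neg hv, if_neg (midSet_comm x y ▸ hv)]
  have hK : ∀ᵐ x ∂volume.restrict B, ∀ᵐ y ∂volume.restrict B,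
      κ (x - y) ≤ ∫⁻ v in B, W x v y := by
    filter_upwards [ae_restrict_mem Metric.isOpen_ball.measurableSet] with x hx
    filter_upwards [ae_restrict_mem Metric.isOpen_ball.measurableSet] with y hy
    rcases eq_or_ne x y with rfl | hxy
    · rw [sub_self, hκ0]
      exact zero_le
    have hℓ : 0 < ‖x - y‖ := norm_pos_iff.2 (sub_ne_zero.2 hxy)
    have hms : MeasurableSet (midSet x y) :=
      measurableSet_midSet.preimage (f := fun v => (x, v, y)) (by fun_prop)
    have e : ∀ v, W x v y = (midSet x y).indicator
        (fun _ => κ (x - y) * ENNReal.ofReal (100 / ‖x - y‖ ^ 2)) v := fun v => by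
      simp only [hW, indicator, mem_ofPred_eq]
    simp_rw [e]
    rw [lintegral_indicator_const hms, Measure.restrict_apply hms, mul_assoc]
    refine le_mul_of_one_le_right' ?_
    refine le_trans ?_ (mul_le_mul_right (volume_midSet_inter_ball_ge hx hy) _)
    rw [← ENNReal.ofReal_mul (by positivity), ← ENNReal.ofReal_one]
    exact ENNReal.ofReal_le_ofReal (le_of_eq (by field_simp))
  -- The weight `100/‖x-y‖²` compensates for the area of admissible `v`. By symmetry both marginals
  -- are bounded by `κ₁`, hence the factor `2·(1+1) = 4`.
  refine (lintegral_sqDiff_le_of_chain_two hu hWm hK h1 h2).trans (le_of_eq ?_)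
  ring

lemma volume_preimage_sub_left (x : E 2) {S : Set (E 2)} (hS : MeasurableSet S) :
    volume {y | x - y ∈ S} = volume S :=
  (Measure.measurePreserving_sub_left volume x).measure_preimage hS.nullMeasurableSet

/-- With `x` and `v` fixed, `‖x-y‖` is determined up to a factor 4. Bounding a marginal thus reduces
to a constant times the area of a set of admissible steps. -/
lemma lintegral_midSet_le {f : E 2 → ℝ≥0∞} {S : Set (E 2)} (hS : MeasurableSet S) {x v : E 2}
    {C : ℝ≥0∞} (h : ∀ y, v ∈ midSet x y → ‖x - v‖ ≤ ‖x - y‖ → ‖x - y‖ ≤ 4 * ‖x - v‖ →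
      f y ≤ S.indicator (fun _ => C) (x - y)) :
    ∫⁻ y, {y | v ∈ midSet x y}.indicator f y ≤ C * volume S := by
  have hS' : MeasurableSet {y | x - y ∈ S} := hS.preimage (by fun_prop)
  rw [← volume_preimage_sub_left x hS, ← lintegral_indicator_const hS']
  refine lintegral_mono fun y => ?_
  by_cases hy : v ∈ midSet x y
  · obtain ⟨h1, h2⟩ := norm_sub_le_of_mem_midSet hy
    rw [indicator_of_mem (show y ∈ {y | v ∈ midSet x y} from hy)]
    exact h y hy (by linarith [norm_nonneg (x - y)]) h2
  · rw [indicator_of_notMem (show y ∉ {y | v ∈ midSet x y} from hy)]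
    exact zero_le

/-! ### The upper bound in (A) -/

lemma energy_eq_lintegral_sqDiff {d : ℕ} (k : E d → E d → ℝ) (D : Set (E d)) (u : E d → ℝ) :
    energy k D u = ∫⁻ x in D, ∫⁻ y in D, sqDiff u x y * ENNReal.ofReal (k x y) := by
  simp only [energy, sqDiff, ENNReal.ofReal_mul (sq_nonneg _)]

lemma stableKernel_eq (α : ℝ) (x y : E 2) :
    stableKernel 2 α x y = (2 - α) * ‖x - y‖ ^ (-2 - α) := by
  simp [stableKernel]

/-- Splitting thorn jumps near the midpoint gives, at `d = ‖x-v‖`, a marginal of order `d^(-2-β)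
d^(-2) d^(1+1/b) = d^(-2-α)`: the small area of the thorns exactly offsets the stronger singularity.
-/
lemma energy_thornKernel_le {b α : ℝ} (hb : b ∈ Ioo (0 : ℝ) 1) (hα : α ∈ Ioo (0 : ℝ) 2)
    (x₀ : E 2) (r : ℝ) {u : E 2 → ℝ} (hu : Measurable u) :
    energy (thornKernel b α) (Metric.ball x₀ r) u ≤
      ENNReal.ofReal (3200 * 4 ^ (1 + 1 / b)) *
        energy (stableKernel 2 α) (Metric.ball x₀ r) u := by
  have h2α : 0 < 2 - α := by linarith [hα.2]
  have hα0 := hα.1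
  have hb0 := hb.1
  have h1b : 1 < 1 / b := by rw [lt_div_iff₀ hb0]; linarith [hb.2]
  set C := 800 * (4 : ℝ) ^ (1 + 1 / b) with hC
  have h0 : thornFunction b α 0 = 0 := by
    unfold thornFunction
    split_ifs
    · rw [norm_zero, Real.zero_rpow (by linarith), mul_zero]
    · rfl
  have main := lintegral_sqDiff_le_of_midSet (κ := fun z => ENNReal.ofReal (thornFunction b α z))
    (κ₁ := fun z => ENNReal.ofReal C * ENNReal.ofReal ((2 - α) * ‖z‖ ^ (-2 - α)))
    (measurable_thornFunction b α).ennreal_ofReal (by simp [h0])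
    (fun z => by simp only [thornFunction_neg]) (fun z => by simp only [norm_neg]) ?_ x₀ r hu
  · rw [energy_eq_lintegral_sqDiff, energy_eq_lintegral_sqDiff]
    refine main.trans (le_of_eq ?_)
    have e : ENNReal.ofReal (3200 * 4 ^ (1 + 1 / b)) = 4 * ENNReal.ofReal C := by
      rw [← ENNReal.ofReal_ofNat 4, ← ENNReal.ofReal_mul (by norm_num)]
      congr 1
      rw [hC]
      ring
    rw [e, mul_assoc, ← lintegral_const_mul' _ _ ENNReal.ofReal_ne_top]
    congr 1
    refine lintegral_congr fun x => ?_
    rw [← lintegral_const_mul' _ _ ENNReal.ofReal_ne_top]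
    refine lintegral_congr fun y => ?_
    rw [stableKernel_eq]
    ring
  · intro x v hxv
    have hd : 0 < ‖x - v‖ := norm_pos_iff.2 (sub_ne_zero.2 hxv)
    set d := ‖x - v‖
    set β := α - 1 + 1 / b with hβ
    refine (lintegral_midSet_le (S := thornSet b ∩ Metric.closedBall 0 (4 * d))
      (C := ENNReal.ofReal ((2 - α) * d ^ (-2 - β) * (100 / d ^ 2)))
      ((measurableSet_thornSet b).inter Metric.isClosed_closedBall.measurableSet) ?_).trans ?_
    · intro y _ h1 h2
      by_cases hy : x - y ∈ thornSet b ∩ Metric.ball 0 1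
      · rw [indicator_of_mem (show x - y ∈ thornSet b ∩ Metric.closedBall 0 (4 * d) from
          ⟨hy.1, mem_closedBall_zero_iff.2 h2⟩), thornFunction, if_pos hy,
          ← ENNReal.ofReal_mul (by positivity)]
        refine ENNReal.ofReal_le_ofReal ?_
        have : ‖x - y‖ ^ (-2 - β) ≤ d ^ (-2 - β) :=
          Real.rpow_le_rpow_of_nonpos hd h1 (by linarith)
        gcongr
      · rw [thornFunction, if_neg hy]
        simp
    · refine (mul_le_mul_right
        (volume_thornSet_inter_closedBall_le hb0 (by positivity : 0 ≤ 4 * d)) _).trans ?_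
      rw [← ENNReal.ofReal_mul (by positivity), ← ENNReal.ofReal_mul (by positivity)]
      refine ENNReal.ofReal_le_ofReal (le_of_eq ?_)
      have e : d ^ (-2 - α) * d ^ 2 = d ^ (-2 - β) * d ^ (1 + 1 / b) := by
        rw [← Real.rpow_natCast, ← Real.rpow_add hd, ← Real.rpow_add hd]
        congr 1
        rw [hβ]
        push_cast
        ring
      rw [hC, Real.mul_rpow (by norm_num) hd.le]
      calc _ = 800 * 4 ^ (1 + 1 / b) * ((2 - α) * (d ^ (-2 - β) * d ^ (1 + 1 / b) / d ^ 2)) := by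
            ring
        _ = _ := by rw [← e, mul_div_cancel_right₀ _ (by positivity)]

/-! ### Reduction of the stable form to short jumps away from the axes -/

/-- The kernel `|z|^{-2-α}` restricted to `|z| ≤ s`. -/
noncomputable def shortKernel (α s : ℝ) : E 2 → ℝ≥0∞ :=
  {z | ‖z‖ ≤ s}.indicator fun z => ENNReal.ofReal (‖z‖ ^ (-2 - α))

/-- The kernel `|z|^{-2-α}` restricted to `|z| ≤ s` and to directions away from the axes. -/
noncomputable def coneKernel (α s : ℝ) : E 2 → ℝ≥0∞ :=
  {z | ‖z‖ ≤ s ∧ ∀ i, ‖z‖ / 100 ≤ |z i|}.indicator fun z => ENNReal.ofReal (‖z‖ ^ (-2 - α))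

lemma coneKernel_le_shortKernel (α s : ℝ) (z : E 2) : coneKernel α s z ≤ shortKernel α s z :=
  indicator_le_indicator_of_subset (fun _ h => h.1) (fun _ => zero_le) z

/-- Both halves of a split jump are at most `3/4` as long, and the points of `midSet` are chosen so
that neither half is nearly parallel to an axis. The constant is `25600 = 4 · 6400`, with `6400 =
100 · 4 · 4²` from the weight and the area of `B_{4d}`. -/
lemma lintegral_shortKernel_le_coneKernel {α : ℝ} (hα : α ∈ Ioo (0 : ℝ) 2) (s : ℝ)
    (x₀ : E 2) (r : ℝ) {u : E 2 → ℝ} (hu : Measurable u) :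
    ∫⁻ x in Metric.ball x₀ r, ∫⁻ y in Metric.ball x₀ r, sqDiff u x y * shortKernel α s (x - y) ≤
      25600 * ∫⁻ x in Metric.ball x₀ r, ∫⁻ y in Metric.ball x₀ r,
        sqDiff u x y * coneKernel α (3 / 4 * s) (x - y) := by
  have hα0 := hα.1
  have main := lintegral_sqDiff_le_of_midSet (κ := shortKernel α s)
    (κ₁ := fun z => 6400 * coneKernel α (3 / 4 * s) z) ?_ ?_ ?_ ?_ ?_ x₀ r hu
  · refine main.trans (le_of_eq ?_)
    rw [show (25600 : ℝ≥0∞) = 4 * 6400 by norm_num, mul_assoc,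
      ← lintegral_const_mul' 6400 _ (by norm_num)]
    congr 1
    refine lintegral_congr fun x => ?_
    rw [← lintegral_const_mul' 6400 _ (by norm_num)]
    refine lintegral_congr fun y => ?_
    ring
  · exact Measurable.indicator (by fun_prop) (measurableSet_le (by fun_prop) (by fun_prop))
  · simp only [shortKernel, indicator, norm_zero, Real.zero_rpow (by linarith : -2 - α ≠ 0)]
    simp
  · intro z
    simp [shortKernel, indicator]
  · intro z
    simp [coneKernel, indicator]
  · intro x v hxv
    have hd : 0 < ‖x - v‖ := norm_pos_iff.2 (sub_ne_zero.2 hxv)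
    by_cases hmem : x - v ∈ {z : E 2 | ‖z‖ ≤ 3 / 4 * s ∧ ∀ i, ‖z‖ / 100 ≤ |z i|}
    · rw [coneKernel, indicator_of_mem hmem]
      set d := ‖x - v‖
      refine (lintegral_midSet_le (S := Metric.closedBall 0 (4 * d))
        (C := ENNReal.ofReal (d ^ (-2 - α) * (100 / d ^ 2)))
        Metric.isClosed_closedBall.measurableSet ?_).trans ?_
      · intro y _ h1 h2
        rw [indicator_of_mem (mem_closedBall_zero_iff.2 h2), ENNReal.ofReal_mul (by positivity)]
        refine mul_le_mul' ((indicator_le_self _ _ _).trans (ENNReal.ofReal_le_ofReal ?_))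
          (ENNReal.ofReal_le_ofReal (by gcongr))
        exact Real.rpow_le_rpow_of_nonpos hd h1 (by linarith)
      · refine (mul_le_mul_right (volume_closedBall_le 0 (by positivity : 0 ≤ 4 * d)) _).trans ?_
        rw [← ENNReal.ofReal_ofNat 6400, ← ENNReal.ofReal_mul (by positivity),
          ← ENNReal.ofReal_mul (by positivity)]
        refine ENNReal.ofReal_le_ofReal (le_of_eq ?_)
        field_simp
        norm_num
    · refine le_of_eq_of_le ?_ zero_le
      rw [lintegral_eq_zero_of_ae_eq_zero]
      refine ae_of_all _ fun y => ?_
      by_cases hy : v ∈ midSet x y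
      · rw [indicator_of_mem (show y ∈ {y | v ∈ midSet x y} from hy), shortKernel,
          indicator_of_notMem, zero_mul, Pi.zero_apply]
        intro hs
        have h1 := (norm_sub_le_of_mem_midSet hy).1
        have hs' : ‖x - y‖ ≤ s := hs
        refine hmem ⟨by linarith, fun i => ?_⟩
        have h2 := (hy.2 i).1
        rw [PiLp.sub_apply, abs_sub_comm]
        linarith [norm_nonneg (x - y)]
      · rw [indicator_of_notMem (show y ∉ {y | v ∈ midSet x y} from hy), Pi.zero_apply]

lemma lintegral_shortKernel_le_pow {α : ℝ} (hα : α ∈ Ioo (0 : ℝ) 2) (s : ℝ) (n : ℕ)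
    (x₀ : E 2) (r : ℝ) {u : E 2 → ℝ} (hu : Measurable u) :
    ∫⁻ x in Metric.ball x₀ r, ∫⁻ y in Metric.ball x₀ r, sqDiff u x y * shortKernel α s (x - y) ≤
      25600 ^ n * ∫⁻ x in Metric.ball x₀ r, ∫⁻ y in Metric.ball x₀ r,
        sqDiff u x y * shortKernel α ((3 / 4) ^ n * s) (x - y) := by
  induction n with
  | zero => simp
  | succ n ih =>
    refine ih.trans ?_
    rw [pow_succ, mul_assoc, pow_succ (3 / 4 : ℝ), mul_comm ((3 / 4 : ℝ) ^ n) (3 / 4), mul_assoc]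
    refine mul_le_mul_right ((lintegral_shortKernel_le_coneKernel hα _ x₀ r hu).trans ?_) _
    gcongr
    exact coneKernel_le_shortKernel _ _ _

lemma exists_energy_stableKernel_le {ε : ℝ} (hε : 0 < ε) : ∃ C : ℝ, 0 < C ∧
    ∀ α ∈ Ioo (0 : ℝ) 2, ∀ (x₀ : E 2) (r : ℝ), ∀ u : E 2 → ℝ, Measurable u →
      energy (stableKernel 2 α) (Metric.ball x₀ r) u ≤ ENNReal.ofReal C *
        (ENNReal.ofReal (2 - α) * ∫⁻ x in Metric.ball x₀ r, ∫⁻ y in Metric.ball x₀ r,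
          sqDiff u x y * coneKernel α (ε * r) (x - y)) := by
  -- Points of the ball are at distance at most `2r`, so `n` halvings shrink the range below `ε r`,
  -- and one more yields the cone. The number `n` depends on `ε` only, which keeps the constant
  -- independent of `α` and the ball.
  obtain ⟨n, hn⟩ := exists_pow_lt_of_lt_one (half_pos hε) (by norm_num : (3 / 4 : ℝ) < 1)
  refine ⟨25600 ^ (n + 1), by positivity, fun α hα x₀ r u hu => ?_⟩
  have h2α : 0 < 2 - α := by linarith [hα.2]
  set B := Metric.ball x₀ r
  have h1 : energy (stableKernel 2 α) B u ≤ ENNReal.ofReal (2 - α) *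
      ∫⁻ x in B, ∫⁻ y in B, sqDiff u x y * shortKernel α (2 * r) (x - y) := by
    rw [energy_eq_lintegral_sqDiff, ← lintegral_const_mul' _ _ ENNReal.ofReal_ne_top]
    refine setLIntegral_mono' Metric.isOpen_ball.measurableSet fun x hx => ?_
    rw [← lintegral_const_mul' _ _ ENNReal.ofReal_ne_top]
    refine setLIntegral_mono' Metric.isOpen_ball.measurableSet fun y hy => ?_
    have hxy : ‖x - y‖ ≤ 2 * r := by
      rw [mem_ball_iff_norm] at hx hy
      have := norm_sub_le_norm_sub_add_norm_sub x x₀ y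
      rw [norm_sub_rev x₀ y] at this
      linarith
    rw [shortKernel, indicator_of_mem (show x - y ∈ {z : E 2 | ‖z‖ ≤ 2 * r} from hxy),
      stableKernel_eq, ENNReal.ofReal_mul h2α.le]
    exact le_of_eq (by ring)
  refine h1.trans ?_
  rw [mul_left_comm]
  refine mul_le_mul_right ?_ _
  refine (lintegral_shortKernel_le_pow hα (2 * r) n x₀ r hu).trans ?_
  rw [ENNReal.ofReal_pow (by norm_num), ENNReal.ofReal_ofNat, pow_succ, mul_assoc]
  refine mul_le_mul_right ?_ _
  refine (lintegral_shortKernel_le_coneKernel hα _ x₀ r hu).trans ?_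
  refine mul_le_mul_right (lintegral_mono fun x => lintegral_mono fun y => ?_) _
  -- For `r ≤ 0` the comparison of ranges is not available, but then no nonzero vector meets the
  -- range condition.
  rcases le_or_gt r 0 with hr | hr
  · rcases eq_or_ne x y with rfl | hxy
    · simp [sqDiff_self]
    · have : x - y ∉ {z : E 2 | ‖z‖ ≤ 3 / 4 * ((3 / 4) ^ n * (2 * r)) ∧
          ∀ i, ‖z‖ / 100 ≤ |z i|} := by
        rintro ⟨h, -⟩
        have hpos : 0 < ‖x - y‖ := norm_pos_iff.2 (sub_ne_zero.2 hxy)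
        have : (3 / 4 : ℝ) ^ n * (2 * r) ≤ 0 :=
          mul_nonpos_of_nonneg_of_nonpos (by positivity) (by linarith)
        linarith
      simp only [coneKernel, indicator_of_notMem this, mul_zero, zero_le]
  · refine mul_le_mul_right (indicator_le_indicator_of_subset ?_ (fun _ => zero_le) _) _
    rintro z ⟨h, h'⟩
    refine ⟨h.trans ?_, h'⟩
    have : (3 / 4 : ℝ) ^ n * r ≤ ε / 2 * r := by gcongr
    nlinarith [mul_pos hε hr]

/-! ### Three-step paths along the thorns -/

/-- Moving inwards by about `3ℓ` or more along the larger coordinate lowers `p²` by about `5.8 pℓ`,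
which outweighs the gain of about `2|q|ℓ ≤ 2pℓ` from a sideways move. This needs `p` large compared
with `ℓ`; if `p ≤ r/4`, the point is near the centre and there is room in any case. -/
lemma sq_add_sq_lt_of_inward {p q P Q ℓ r : ℝ} (hq : |q| ≤ p) (hr0 : 0 < r)
    (hr : p ^ 2 + q ^ 2 < r ^ 2) (h0 : 0 ≤ ℓ) (hℓ : ℓ ≤ r / 100) (hP1 : p - 5 * ℓ ≤ P)
    (hP2 : P ≤ p - 29 / 10 * ℓ) (hQ : |Q - q| ≤ 101 / 100 * ℓ) : P ^ 2 + Q ^ 2 < r ^ 2 := by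
  have hp : 0 ≤ p := (abs_nonneg q).trans hq
  have hQ' : |Q| ≤ |q| + 101 / 100 * ℓ := by
    have := abs_sub_abs_le_abs_sub Q q
    linarith
  have hQ2 : Q ^ 2 ≤ (|q| + 101 / 100 * ℓ) ^ 2 := by
    rw [← sq_abs Q]
    exact pow_le_pow_left₀ (abs_nonneg _) hQ' 2
  rcases le_total p (r / 4) with h | h
  · have hP : |P| ≤ 3 / 10 * r := abs_le.2 ⟨by linarith, by linarith⟩
    have h1 : P ^ 2 ≤ (3 / 10 * r) ^ 2 := by
      rw [← sq_abs P]
      exact pow_le_pow_left₀ (abs_nonneg _) hP 2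
    have h2 : (|q| + 101 / 100 * ℓ) ^ 2 ≤ (3 / 10 * r) ^ 2 :=
      pow_le_pow_left₀ (by positivity) (by linarith) 2
    nlinarith [sq_pos_of_pos hr0]
  · have hP : 0 ≤ P := by linarith
    have h1 : P ^ 2 ≤ (p - 29 / 10 * ℓ) ^ 2 := pow_le_pow_left₀ hP hP2 2
    have h2 : |q| * ℓ ≤ p * ℓ := mul_le_mul_of_nonneg_right hq h0
    have h3 : 25 * ℓ * ℓ ≤ p * ℓ := mul_le_mul_of_nonneg_right (by linarith) h0
    have h4 : |q| ^ 2 = q ^ 2 := sq_abs q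
    nlinarith [mul_nonneg h0 h0]

/-- The vectors of the thorn set of length comparable to `ℓ`. -/
def thornSteps (b ℓ : ℝ) : Set (E 2) :=
  {z | z ∈ thornSet b ∧ ℓ / 200 ≤ ‖z‖ ∧ ‖z‖ ≤ 10 * ℓ}

lemma mem_thornSteps_of {b ℓ N : ℝ} (hb : 0 ≤ b) (hℓ : 0 ≤ ℓ) (hN : N ^ b = ℓ / 400)
    (hNℓ : N ≤ ℓ / 400) {z : E 2} {i j : Fin 2} (hij : i ≠ j) (h1 : |z i| ≤ N)
    (h2 : ℓ / 200 ≤ |z j|) (h3 : |z j| ≤ 9 * ℓ) : z ∈ thornSteps b ℓ := by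
  refine ⟨mem_thornSet_of hij ?_, h2.trans (abs_coord_le_norm z j), ?_⟩
  · refine (Real.rpow_le_rpow (abs_nonneg _) h1 hb).trans ?_
    rw [hN]
    linarith
  · have := norm_le_add_abs z hij
    linarith

/-- Two points of a ball are joined inside the ball by many three-step paths along the thorns. -/
lemma exists_thorn_paths {b ℓ N r : ℝ} (hb : 0 ≤ b) (hℓ : 0 ≤ ℓ) (hN0 : 0 ≤ N)
    (hN : N ^ b = ℓ / 400) (hNℓ : N ≤ ℓ / 400) (hℓr : ℓ ≤ r / 100) {x₀ x y : E 2}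
    (hx : x ∈ Metric.ball x₀ r) (hxy : ‖x - y‖ = ℓ) (hcone : ∀ i, ℓ / 100 ≤ |(x - y) i|) :
    ∃ i j : Fin 2, i ≠ j ∧ ∃ τ : ℝ, ∀ v : E 2, v i ∈ Icc τ (τ + ℓ) →
      v j ∈ Icc (x j - N) (x j + N) → v ∈ Metric.ball x₀ r ∧ x - v ∈ thornSteps b ℓ ∧
      ∀ w : E 2, w i ∈ Icc (v i - N) (v i + N) → w j ∈ Icc (y j - N) (y j + N) →
        w ∈ Metric.ball x₀ r ∧ v - w ∈ thornSteps b ℓ ∧ w - y ∈ thornSteps b ℓ := by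
  -- The first step follows the coordinate in which `x` is farther from the centre, so that the
  -- inward direction gains room.
  obtain ⟨i, j, hij, hmax⟩ : ∃ i j : Fin 2, i ≠ j ∧ |x j - x₀ j| ≤ |x i - x₀ i| := by
    rcases le_total |x 1 - x₀ 1| |x 0 - x₀ 0| with h | h
    · exact ⟨0, 1, by decide, h⟩
    · exact ⟨1, 0, by decide, h⟩
  have hball : ∀ z : E 2, 0 < r → (z ∈ Metric.ball x₀ r ↔
      (z i - x₀ i) ^ 2 + (z j - x₀ j) ^ 2 < r ^ 2) := by
    intro z hr
    rw [mem_ball_iff_norm, ← PiLp.sub_apply, ← PiLp.sub_apply, ← norm_sq_eq _ hij,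
      pow_lt_pow_iff_left₀ (norm_nonneg _) hr.le two_ne_zero]
  have hr : 0 < r := (dist_nonneg).trans_lt (Metric.mem_ball.1 hx)
  have hx' := (hball x hr).1 hx
  have hi : |x i - y i| ≤ ℓ := hxy ▸ abs_coord_le_norm (x - y) i
  have hj : |x j - y j| ≤ ℓ := hxy ▸ abs_coord_le_norm (x - y) j
  have hcj : ℓ / 100 ≤ |x j - y j| := hcone j
  -- a point displaced inwards along the larger coordinate stays in the ball
  obtain ⟨τ, hτ, hin⟩ : ∃ τ : ℝ, (∀ t ∈ Icc τ (τ + ℓ), 3 * ℓ ≤ |x i - t| ∧ |x i - t| ≤ 4 * ℓ) ∧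
      ∀ t ∈ Icc τ (τ + ℓ), ∀ z : E 2, |z i - t| ≤ N → |z j - x j| ≤ 101 / 100 * ℓ →
        z ∈ Metric.ball x₀ r := by
    rcases le_total 0 (x i - x₀ i) with h | h
    · rw [abs_of_nonneg h] at hmax
      refine ⟨x i - 4 * ℓ, fun t ht => ?_, fun t ht z h1 h2 => ?_⟩
      · rw [abs_of_nonneg (by linarith [ht.2])]
        exact ⟨by linarith [ht.2], by linarith [ht.1]⟩
      · rw [hball z hr]
        have h1' := abs_le.1 h1
        refine sq_add_sq_lt_of_inward hmax hr hx' hℓ hℓr (by linarith [ht.1]) (by linarith [ht.2]) ?_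
        rwa [sub_sub_sub_cancel_right]
    · rw [abs_of_nonpos h] at hmax
      refine ⟨x i + 3 * ℓ, fun t ht => ?_, fun t ht z h1 h2 => ?_⟩
      · rw [abs_of_nonpos (by linarith [ht.1])]
        exact ⟨by linarith [ht.1], by linarith [ht.2]⟩
      · rw [hball z hr]
        have h1' := abs_le.1 h1
        rw [← neg_sq (z i - x₀ i)]
        rw [← neg_sq (x i - x₀ i)] at hx'
        refine sq_add_sq_lt_of_inward hmax hr hx' hℓ hℓr (by linarith [ht.2]) (by linarith [ht.1]) ?_
        rwa [sub_sub_sub_cancel_right]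
  refine ⟨i, j, hij, τ, fun v hvi hvj => ?_⟩
  have hv : |x j - v j| ≤ N := abs_le.2 ⟨by linarith [hvj.2], by linarith [hvj.1]⟩
  obtain ⟨h3, h4⟩ := hτ _ hvi
  refine ⟨hin _ hvi v (by simpa using hN0) (by rw [abs_sub_comm]; linarith), ?_,
    fun w hwi hwj => ?_⟩
  · exact mem_thornSteps_of hb hℓ hN hNℓ hij.symm (by rwa [PiLp.sub_apply])
      (by rw [PiLp.sub_apply]; linarith) (by rw [PiLp.sub_apply]; linarith)
  · have hwv : |w i - v i| ≤ N := abs_le.2 ⟨by linarith [hwi.1], by linarith [hwi.2]⟩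
    have hwy : |w j - y j| ≤ N := abs_le.2 ⟨by linarith [hwj.1], by linarith [hwj.2]⟩
    refine ⟨hin _ hvi w hwv ?_, ?_, ?_⟩
    · have e : w j - x j = (w j - y j) - (x j - y j) := by ring
      have := abs_sub (w j - y j) (x j - y j)
      rw [e]
      linarith
    -- The sideways step covers `x j - y j` up to `2N`, so its length is at least `ℓ/100 - ℓ/200 =
    -- ℓ/200`. This is where the cone condition enters.
    · have e : (v - w) j = (x j - y j) - ((x j - v j) + (w j - y j)) := by
        rw [PiLp.sub_apply]; ring
      have t1 := abs_add_le (x j - v j) (w j - y j)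
      have t2 := abs_sub (x j - y j) ((x j - v j) + (w j - y j))
      have t3 := abs_sub_abs_le_abs_sub (x j - y j) ((x j - v j) + (w j - y j))
      refine mem_thornSteps_of hb hℓ hN hNℓ hij ?_ ?_ ?_
      · rwa [PiLp.sub_apply, abs_sub_comm]
      · rw [e]; linarith
      · rw [e]; linarith
    -- Going back still takes at least `3ℓ - ℓ - N`, because `|x i - y i| ≤ ℓ`. The inward
    -- displacement was chosen to exceed `ℓ` for this reason.
    · have e : (w - y) i = ((w i - v i) + (x i - y i)) - (x i - v i) := by
        rw [PiLp.sub_apply]; ring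
      have t1 := abs_add_le (w i - v i) (x i - y i)
      have t2 := abs_sub ((w i - v i) + (x i - y i)) (x i - v i)
      have t3 := abs_sub_abs_le_abs_sub (x i - v i) ((w i - v i) + (x i - y i))
      rw [abs_sub_comm (x i - v i)] at t3
      refine mem_thornSteps_of hb hℓ hN hNℓ hij.symm (by rwa [PiLp.sub_apply]) ?_ ?_
      · rw [e]; linarith
      · rw [e]; linarith

/-! ### The path density and its marginals -/

/-- The density of three-step paths along the thorns. -/
noncomputable def pathDensity (b α : ℝ) (x v w y : E 2) : ℝ≥0∞ :=
  {p : E 2 × E 2 × E 2 × E 2 | ‖p.1 - p.2.2.2‖ ≤ 1 / 100 ∧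
    p.1 - p.2.1 ∈ thornSteps b ‖p.1 - p.2.2.2‖ ∧ p.2.1 - p.2.2.1 ∈ thornSteps b ‖p.1 - p.2.2.2‖ ∧
    p.2.2.1 - p.2.2.2 ∈ thornSteps b ‖p.1 - p.2.2.2‖}.indicator
  (fun p => ENNReal.ofReal (400 ^ (3 / b) / 8 * ‖p.1 - p.2.2.2‖ ^ (-3 - α - 3 / b))) (x, v, w, y)

lemma measurable_pathDensity (b α : ℝ) :
    Measurable fun p : E 2 × E 2 × E 2 × E 2 => pathDensity b α p.1 p.2.1 p.2.2.1 p.2.2.2 := by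
  refine Measurable.indicator (by fun_prop) ?_
  have hl : Measurable fun p : E 2 × E 2 × E 2 × E 2 => ‖p.1 - p.2.2.2‖ := by fun_prop
  have hs : ∀ g : E 2 × E 2 × E 2 × E 2 → E 2, Measurable g →
      MeasurableSet {p | g p ∈ thornSteps b ‖p.1 - p.2.2.2‖} := fun g hg =>
    ((measurableSet_thornSet b).preimage hg).inter ((measurableSet_le (hl.div_const _) hg.norm).inter
      (measurableSet_le hg.norm (hl.const_mul _)))
  exact (measurableSet_le hl measurable_const).inter ((hs _ (by fun_prop)).inter
    ((hs _ (by fun_prop)).inter (hs _ (by fun_prop))))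

/-- The admissible `v` fill a rectangle of area `2ℓN` and, for each of them, the admissible `w` fill
a square of area `4N²`. The density is `ℓ^(-2-α)` divided by `8ℓN³`, since `N³ = (ℓ/400)^(3/b)`. -/
lemma coneKernel_le_lintegral_pathDensity {b α r : ℝ} (hb : b ∈ Ioo (0 : ℝ) 1)
    (hα : α ∈ Ioo (0 : ℝ) 2) (hr : r ≤ 1) {x₀ x y : E 2} (hx : x ∈ Metric.ball x₀ r) :
    coneKernel α (1 / 100 * r) (x - y) ≤
      ∫⁻ v in Metric.ball x₀ r, ∫⁻ w in Metric.ball x₀ r, pathDensity b α x v w y := by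
  by_cases hmem : x - y ∈ {z : E 2 | ‖z‖ ≤ 1 / 100 * r ∧ ∀ i, ‖z‖ / 100 ≤ |z i|}
  swap
  · rw [coneKernel, indicator_of_notMem hmem]
    exact zero_le
  rw [coneKernel, indicator_of_mem hmem]
  obtain ⟨hle, hcone⟩ := hmem
  set ℓ := ‖x - y‖ with hℓ
  rcases (norm_nonneg (x - y)).eq_or_lt with h0 | h0
  · rw [hℓ, ← h0, Real.zero_rpow (by linarith [hα.1])]
    simp
  have hb0 := hb.1
  have h1b : 1 ≤ 1 / b := by rw [le_div_iff₀ hb0]; linarith [hb.2]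
  have hℓ0 : 0 < ℓ := h0
  -- A short coordinate up to this size satisfies the thorn inequality whenever the long one is at
  -- least `ℓ/400`, and every step has long coordinate at least `ℓ/200`.
  set N := (ℓ / 400) ^ (1 / b) with hNdef
  have hN0 : 0 < N := by positivity
  have hN : N ^ b = ℓ / 400 := by
    rw [hNdef, ← Real.rpow_mul (by positivity), one_div_mul_cancel hb0.ne', Real.rpow_one]
  have hNℓ : N ≤ ℓ / 400 := Real.rpow_le_self_of_le_one (by positivity) (by linarith) h1b
  obtain ⟨i, j, hij, τ, H⟩ := exists_thorn_paths hb0.le hℓ0.le hN0.le hN hNℓ (by linarith) hx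
    hℓ.symm hcone
  set B := Metric.ball x₀ r
  set c := ENNReal.ofReal (400 ^ (3 / b) / 8 * ℓ ^ (-3 - α - 3 / b)) with hc
  set R := {v : E 2 | v i ∈ Icc τ (τ + ℓ) ∧ v j ∈ Icc (x j - N) (x j + N)}
  have hRm : MeasurableSet R := (measurableSet_Icc.preimage (by fun_prop)).inter
    (measurableSet_Icc.preimage (by fun_prop))
  have inner : ∀ v ∈ R, c * ENNReal.ofReal (2 * N * (2 * N)) ≤
      ∫⁻ w in B, pathDensity b α x v w y := by
    rintro v ⟨hvi, hvj⟩
    obtain ⟨-, hv2, hw⟩ := H v hvi hvj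
    set Q := {w : E 2 | w i ∈ Icc (v i - N) (v i + N) ∧ w j ∈ Icc (y j - N) (y j + N)} with hQ
    have hQm : MeasurableSet Q := (measurableSet_Icc.preimage (by fun_prop)).inter
      (measurableSet_Icc.preimage (by fun_prop))
    have hQv : volume Q = ENNReal.ofReal (2 * N * (2 * N)) := by
      rw [hQ, volume_box hij measurableSet_Icc measurableSet_Icc, Real.volume_Icc, Real.volume_Icc,
        ← ENNReal.ofReal_mul (by linarith)]
      congr 1
      ring
    have hQB : Q ⊆ B := fun w h => (hw w h.1 h.2).1
    calc c * ENNReal.ofReal (2 * N * (2 * N)) = ∫⁻ w in B, Q.indicator (fun _ => c) w := by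
          rw [lintegral_indicator_const hQm, Measure.restrict_apply hQm,
            inter_eq_left.2 hQB, hQv]
      _ ≤ _ := by
          refine lintegral_mono fun w => ?_
          by_cases hwQ : w ∈ Q
          · obtain ⟨-, h1, h2⟩ := hw w hwQ.1 hwQ.2
            rw [indicator_of_mem hwQ, pathDensity, indicator_of_mem]
            exact ⟨by simp only; linarith, hv2, h1, h2⟩
          · rw [indicator_of_notMem hwQ]
            exact zero_le
  have hRB : R ⊆ B := fun v h => (H v h.1 h.2).1
  have hRv : volume R = ENNReal.ofReal (ℓ * (2 * N)) := by
    rw [volume_box hij measurableSet_Icc measurableSet_Icc, Real.volume_Icc, Real.volume_Icc,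
      ← ENNReal.ofReal_mul (by linarith)]
    congr 1
    ring
  calc ENNReal.ofReal (ℓ ^ (-2 - α))
      = c * ENNReal.ofReal (2 * N * (2 * N)) * ENNReal.ofReal (ℓ * (2 * N)) := by
        rw [hc, ← ENNReal.ofReal_mul (by positivity), ← ENNReal.ofReal_mul (by positivity)]
        congr 1
        have e1 : N ^ 3 = ℓ ^ (3 / b) / 400 ^ (3 / b) := by
          rw [hNdef, ← Real.rpow_natCast, ← Real.rpow_mul (by positivity),
            ← Real.div_rpow hℓ0.le (by norm_num)]
          congr 1
          push_cast
          ring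
        have e2 : ℓ ^ (-2 - α) = ℓ ^ (-3 - α - 3 / b) * ℓ * ℓ ^ (3 / b) := by
          nth_rewrite 3 [← Real.rpow_one ℓ]
          rw [← Real.rpow_add hℓ0, ← Real.rpow_add hℓ0]
          congr 1
          ring
        calc _ = 400 ^ (3 / b) * (ℓ ^ (-3 - α - 3 / b) * ℓ) * (ℓ ^ (3 / b) / 400 ^ (3 / b)) := by
              rw [e2]
              have : (400 : ℝ) ^ (3 / b) ≠ 0 := by positivity
              field_simp
          _ = _ := by rw [← e1]; ring
    _ = ∫⁻ v in B, R.indicator (fun _ => c * ENNReal.ofReal (2 * N * (2 * N))) v := by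
        rw [lintegral_indicator_const hRm, Measure.restrict_apply hRm, inter_eq_left.2 hRB, hRv]
    _ ≤ _ := by
        refine lintegral_mono fun v => ?_
        by_cases hv : v ∈ R
        · rw [indicator_of_mem hv]
          exact inner v hv
        · rw [indicator_of_notMem hv]
          exact zero_le

/-- The thorn kernel without the factor `2 - α`. -/
noncomputable def thornWeight (b α : ℝ) : E 2 → ℝ≥0∞ :=
  (thornSet b ∩ Metric.ball 0 1).indicator
    fun z => ENNReal.ofReal (‖z‖ ^ (-2 - (α - 1 + 1 / b)))

lemma ofReal_thornKernel {b α : ℝ} (hα : α < 2) (x y : E 2) :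
    ENNReal.ofReal (thornKernel b α x y) = ENNReal.ofReal (2 - α) * thornWeight b α (x - y) := by
  rw [thornKernel, thornFunction, thornWeight]
  split_ifs with h
  · rw [indicator_of_mem h, ENNReal.ofReal_mul (by linarith)]
  · rw [indicator_of_notMem h, mul_zero, ENNReal.ofReal_zero]

lemma lintegral_lintegral_le_of_le_mul {β : Type*} [MeasurableSpace β] {μ : Measure β}
    {G D : β → β → ℝ≥0∞} {A : β → ℝ≥0∞} {M V : ℝ≥0∞} (hM : M ≠ ⊤) (hA : ∀ p, A p ≠ ⊤)
    (hG : ∀ p q, G p q ≤ M * A p * D p q) (hAV : ∫⁻ p, A p ∂μ ≤ V)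
    (hDV : ∀ p, ∫⁻ q, D p q ∂μ ≤ V) (s : Set β) :
    ∫⁻ p in s, ∫⁻ q in s, G p q ∂μ ∂μ ≤ M * V * V := by
  calc _ ≤ ∫⁻ p, ∫⁻ q, M * A p * D p q ∂μ ∂μ :=
        (setLIntegral_le_lintegral _ _).trans (lintegral_mono fun p =>
          (setLIntegral_le_lintegral _ _).trans (lintegral_mono fun q => hG p q))
    _ ≤ ∫⁻ p, M * V * A p ∂μ := by
        refine lintegral_mono fun p => ?_
        simp only
        rw [lintegral_const_mul' _ _ (ENNReal.mul_ne_top hM (hA p)), mul_right_comm]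
        gcongr
        exact hDV p
    _ ≤ _ := by
        rcases eq_or_ne V ⊤ with rfl | hV
        · rcases eq_or_ne M 0 with rfl | hM0
          · simp
          · simp [ENNReal.mul_top hM0]
        · rw [lintegral_const_mul' _ _ (ENNReal.mul_ne_top hM hV)]
          gcongr

/-- The constant in the bound for the marginals of the path density. -/
noncomputable def pathConst (b : ℝ) : ℝ :=
  400 ^ (3 / b) / 8 * 10 ^ (5 + 3 / b) * (8 * 2000 ^ (1 + 1 / b)) ^ 2

/-- Fixing one step `z` pins `ℓ` down to the order of `d = ‖z‖`, and the other two steps each range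
over a piece of the thorn set of area of order `d^(1+1/b)`. The exponents add to `-3-α-3/b+2+2/b =
-2-β`. The maps `a` and `c` stand for the two free steps, so one argument serves for every position
of the fixed step. -/
lemma pathDensity_marginal_le {b α : ℝ} (hb : 0 < b) (hα : α ∈ Ioo (0 : ℝ) 2) {z : E 2}
    (hz : z ≠ 0) {G : E 2 → E 2 → ℝ≥0∞} {a c : E 2 → E 2 → E 2} {ℓ : E 2 → E 2 → ℝ}
    (hG : ∀ p q, G p q ≠ 0 → ℓ p q ≤ 1 / 100 ∧ z ∈ thornSteps b (ℓ p q) ∧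
      a p q ∈ thornSteps b (ℓ p q) ∧ c p q ∈ thornSteps b (ℓ p q) ∧
      G p q ≤ ENNReal.ofReal (400 ^ (3 / b) / 8 * ℓ p q ^ (-3 - α - 3 / b)))
    (ha : ∀ p q q', a p q = a p q')
    (haV : ∀ T : Set (E 2), MeasurableSet T → ∀ q, volume {p | a p q ∈ T} = volume T)
    (ham : ∀ q, Measurable fun p => a p q)
    (hcV : ∀ T : Set (E 2), MeasurableSet T → ∀ p, volume {q | c p q ∈ T} = volume T)
    (hcm : ∀ p, Measurable (c p)) (s : Set (E 2)) :
    ∫⁻ p in s, ∫⁻ q in s, G p q ≤ ENNReal.ofReal (pathConst b) * thornWeight b α z := by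
  have hd : 0 < ‖z‖ := norm_pos_iff.2 hz
  have hα0 := hα.1
  set d := ‖z‖ with hdz
  by_cases hmem : z ∈ thornSet b ∩ Metric.ball 0 1
  swap
  -- The truncation `ℓ ≤ 1/100` keeps every step shorter than `10/100`, hence inside the unit ball
  -- where the thorn kernel lives.
  · have : ∀ p q, G p q = 0 := by
      intro p q
      by_contra h
      obtain ⟨h1, h2, -⟩ := hG p q h
      refine hmem ⟨h2.1, ?_⟩
      rw [mem_ball_zero_iff]
      linarith [h2.2.2]
    simp [this]
  -- Here `2000 = 10 · 200`: a step is at most `10ℓ`, and `ℓ ≤ 200 d`.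
  set T := thornSet b ∩ Metric.closedBall 0 (2000 * d)
  have hT : MeasurableSet T :=
    (measurableSet_thornSet b).inter Metric.isClosed_closedBall.measurableSet
  set V := ENNReal.ofReal (8 * (2000 * d) ^ (1 + 1 / b)) with hV
  have hTV : volume T ≤ V := volume_thornSet_inter_closedBall_le hb (by positivity)
  set M := ENNReal.ofReal (400 ^ (3 / b) / 8 * (d / 10) ^ (-3 - α - 3 / b)) with hM
  have key := lintegral_lintegral_le_of_le_mul (μ := volume) (G := G) (M := M) (V := V)
    (A := fun p => T.indicator (fun _ => 1) (a p 0)) (D := fun p q => T.indicator (fun _ => 1) (c p q))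
    ENNReal.ofReal_ne_top (fun p => ?_) (fun p q => ?_) ?_ (fun p => ?_) s
  · refine key.trans (le_of_le_of_eq ?_ (by rw [thornWeight, indicator_of_mem hmem]))
    rw [hM, hV, ← ENNReal.ofReal_mul (by positivity), ← ENNReal.ofReal_mul (by positivity),
      ← ENNReal.ofReal_mul (by unfold pathConst; positivity)]
    refine ENNReal.ofReal_le_ofReal ?_
    rw [← hdz]
    have e1 : (d / 10) ^ (-3 - α - 3 / b) ≤ 10 ^ (5 + 3 / b) * d ^ (-3 - α - 3 / b) := by
      rw [div_eq_inv_mul, Real.mul_rpow (by norm_num) hd.le, Real.inv_rpow (by norm_num),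
        ← Real.rpow_neg (by norm_num)]
      refine mul_le_mul_of_nonneg_right ?_ (by positivity)
      exact Real.rpow_le_rpow_of_exponent_le (by norm_num) (by linarith [hα.2])
    have e2 : d ^ (-3 - α - 3 / b) * (d ^ (1 + 1 / b)) ^ 2 = d ^ (-2 - (α - 1 + 1 / b)) := by
      rw [← Real.rpow_natCast, ← Real.rpow_mul hd.le, ← Real.rpow_add hd]
      congr 1
      push_cast
      ring
    rw [Real.mul_rpow (by norm_num) hd.le, ← e2, pathConst]
    calc _ = 400 ^ (3 / b) / 8 * (d / 10) ^ (-3 - α - 3 / b) *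
          ((8 * 2000 ^ (1 + 1 / b)) ^ 2 * (d ^ (1 + 1 / b)) ^ 2) := by ring
      _ ≤ 400 ^ (3 / b) / 8 * (10 ^ (5 + 3 / b) * d ^ (-3 - α - 3 / b)) *
          ((8 * 2000 ^ (1 + 1 / b)) ^ 2 * (d ^ (1 + 1 / b)) ^ 2) := by gcongr
      _ = _ := by ring
  · simp only [indicator]
    split_ifs <;> simp
  · by_cases h : G p q = 0
    · rw [h]
      exact zero_le
    obtain ⟨-, h2, h3, h4, h5⟩ := hG p q h
    have hb1 : d / 10 ≤ ℓ p q := by linarith [h2.2.2]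
    have hb2 : ℓ p q ≤ 200 * d := by linarith [h2.2.1]
    have h3' : a p 0 ∈ T := by
      rw [ha p 0 q]
      exact ⟨h3.1, mem_closedBall_zero_iff.2 (by linarith [h3.2.2])⟩
    have h4' : c p q ∈ T := ⟨h4.1, mem_closedBall_zero_iff.2 (by linarith [h4.2.2])⟩
    rw [indicator_of_mem h3', indicator_of_mem h4', mul_one, mul_one]
    refine h5.trans (ENNReal.ofReal_le_ofReal ?_)
    refine mul_le_mul_of_nonneg_left ?_ (by positivity)
    have : 0 < 3 / b := by positivity
    exact Real.rpow_le_rpow_of_nonpos (by positivity) hb1 (by linarith)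
  · refine (le_of_eq (lintegral_indicator_const (hT.preimage (ham 0)) 1)).trans ?_
    rw [one_mul]
    exact (haV T hT 0).le.trans hTV
  · refine (le_of_eq (lintegral_indicator_const (hT.preimage (hcm p)) 1)).trans ?_
    rw [one_mul]
    exact (hcV T hT p).le.trans hTV

lemma of_pathDensity_ne_zero {b α : ℝ} {x v w y : E 2} (h : pathDensity b α x v w y ≠ 0) :
    ‖x - y‖ ≤ 1 / 100 ∧ x - v ∈ thornSteps b ‖x - y‖ ∧ v - w ∈ thornSteps b ‖x - y‖ ∧
      w - y ∈ thornSteps b ‖x - y‖ ∧ pathDensity b α x v w y ≤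
        ENNReal.ofReal (400 ^ (3 / b) / 8 * ‖x - y‖ ^ (-3 - α - 3 / b)) := by
  obtain ⟨h1, h2, h3, h4⟩ := mem_of_indicator_ne_zero h
  exact ⟨h1, h2, h3, h4, indicator_le_self _ _ _⟩

lemma volume_preimage_sub_right (y : E 2) {S : Set (E 2)} (hS : MeasurableSet S) :
    volume {x | x - y ∈ S} = volume S :=
  (measurePreserving_sub_right volume y).measure_preimage hS.nullMeasurableSet

lemma lintegral_coneKernel_le_thornWeight {b α r : ℝ} (hb : b ∈ Ioo (0 : ℝ) 1)
    (hα : α ∈ Ioo (0 : ℝ) 2) (hr : r ≤ 1) (x₀ : E 2) {u : E 2 → ℝ} (hu : Measurable u) :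
    ∫⁻ x in Metric.ball x₀ r, ∫⁻ y in Metric.ball x₀ r,
        sqDiff u x y * coneKernel α (1 / 100 * r) (x - y) ≤
      9 * ∫⁻ x in Metric.ball x₀ r, ∫⁻ y in Metric.ball x₀ r,
        sqDiff u x y * (ENNReal.ofReal (pathConst b) * thornWeight b α (x - y)) := by
  refine lintegral_sqDiff_le_of_chain_three hu (W := pathDensity b α)
    (K := fun x y => coneKernel α (1 / 100 * r) (x - y))
    (K' := fun x y => ENNReal.ofReal (pathConst b) * thornWeight b α (x - y))
    (measurable_pathDensity b α) ?_ ?_ ?_ ?_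
  · filter_upwards [ae_restrict_mem Metric.isOpen_ball.measurableSet] with x hx
    exact ae_of_all _ fun y => coneKernel_le_lintegral_pathDensity hb hα hr hx
  · intro x v hxv
    refine pathDensity_marginal_le hb.1 hα (sub_ne_zero.2 hxv) (a := fun w _ => v - w)
      (c := fun w y => w - y) (ℓ := fun _ y => ‖x - y‖) (fun w y h => ?_) (fun _ _ _ => rfl)
      (fun T hT _ => volume_preimage_sub_left v hT) (fun _ => by fun_prop)
      (fun T hT w => volume_preimage_sub_left w hT) (fun _ => by fun_prop) _
    obtain ⟨h1, h2, h3, h4, h5⟩ := of_pathDensity_ne_zero h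
    exact ⟨h1, h2, h3, h4, h5⟩
  · intro v w hvw
    refine pathDensity_marginal_le hb.1 hα (sub_ne_zero.2 hvw) (a := fun x _ => x - v)
      (c := fun _ y => w - y) (ℓ := fun x y => ‖x - y‖) (fun x y h => ?_) (fun _ _ _ => rfl)
      (fun T hT _ => volume_preimage_sub_right v hT) (fun _ => by fun_prop)
      (fun T hT _ => volume_preimage_sub_left w hT) (fun _ => by fun_prop) _
    obtain ⟨h1, h2, h3, h4, h5⟩ := of_pathDensity_ne_zero h
    exact ⟨h1, h3, h2, h4, h5⟩
  · intro w y hwy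
    refine pathDensity_marginal_le hb.1 hα (sub_ne_zero.2 hwy) (a := fun v _ => v - w)
      (c := fun v x => x - v) (ℓ := fun _ x => ‖x - y‖) (fun v x h => ?_) (fun _ _ _ => rfl)
      (fun T hT _ => volume_preimage_sub_right w hT) (fun _ => by fun_prop)
      (fun T hT v => volume_preimage_sub_right v hT) (fun _ => by fun_prop) _
    obtain ⟨h1, h2, h3, h4, h5⟩ := of_pathDensity_ne_zero h
    exact ⟨h1, h4, h3, h2, h5⟩

/-! ### The lower bound in (A) and conclusion -/

lemma exists_energy_stableKernel_le_thornKernel {b : ℝ} (hb : b ∈ Ioo (0 : ℝ) 1) :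
    ∃ C : ℝ, 0 < C ∧ ∀ α ∈ Ioo (0 : ℝ) 2, ∀ (x₀ : E 2), ∀ r ≤ (1 : ℝ), ∀ u : E 2 → ℝ,
      Measurable u → energy (stableKernel 2 α) (Metric.ball x₀ r) u ≤
        ENNReal.ofReal C * energy (thornKernel b α) (Metric.ball x₀ r) u := by
  -- The paths need `ℓ ≤ r/100` to stay in the ball, which fixes `ε = 1/100`.
  obtain ⟨C, hC, H⟩ := exists_energy_stableKernel_le (by norm_num : (0 : ℝ) < 1 / 100)
  have hb0 := hb.1
  have hp : 0 < pathConst b := by unfold pathConst; positivity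
  refine ⟨C * (9 * pathConst b), by positivity, fun α hα x₀ r hr u hu => ?_⟩
  refine (H α hα x₀ r u hu).trans ?_
  rw [ENNReal.ofReal_mul hC.le, mul_assoc]
  refine mul_le_mul_right ((mul_le_mul_right
    (lintegral_coneKernel_le_thornWeight hb hα hr x₀ hu) _).trans (le_of_eq ?_)) _
  rw [ENNReal.ofReal_mul (by norm_num), ENNReal.ofReal_ofNat, mul_left_comm, mul_assoc,
    energy_eq_lintegral_sqDiff, ← lintegral_const_mul' _ _ ENNReal.ofReal_ne_top,
    ← lintegral_const_mul' _ _ ENNReal.ofReal_ne_top]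
  congr 1
  refine lintegral_congr fun x => ?_
  rw [← lintegral_const_mul' _ _ ENNReal.ofReal_ne_top,
    ← lintegral_const_mul' _ _ ENNReal.ofReal_ne_top]
  refine lintegral_congr fun y => ?_
  rw [ofReal_thornKernel hα.2]
  ring

/-- Both constants depend on `b` only and serve all `α` in `(0,2)`. By contrast, the constant
obtained for (B) degenerates as `α₀ → 0`, through `2/α₀`. -/
lemma condA_thornKernel {b α₀ : ℝ} (hb : b ∈ Ioo (0 : ℝ) 1) (hα₀ : 0 ≤ α₀) :
    CondA α₀ (thornKernel b) := by
  obtain ⟨C, hC, H⟩ := exists_energy_stableKernel_le_thornKernel hb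
  have hb0 := hb.1
  refine ⟨C⁻¹, 3200 * 4 ^ (1 + 1 / b), by positivity, by positivity,
    fun α hα x₀ r hr u hu => ?_⟩
  have hα' : α ∈ Ioo (0 : ℝ) 2 := ⟨hα₀.trans_lt hα.1, hα.2⟩
  have hum : Measurable u := hu.1.continuous.measurable
  refine ⟨?_, energy_thornKernel_le hb hα' x₀ r hum⟩
  refine (mul_le_mul_right (H α hα' x₀ r hr.2.le u hum) _).trans (le_of_eq ?_)
  rw [← mul_assoc, ← ENNReal.ofReal_mul (by positivity), inv_mul_cancel₀ hC.ne',
    ENNReal.ofReal_one, one_mul]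

end NonlocalForms

theorem mainTheorem6 (b : ℝ) (hb : b ∈ Set.Ioo (0 : ℝ) 1) :
    (∀ α ∈ Set.Ioo (0 : ℝ) 2, NonlocalForms.IsAdmissible (NonlocalForms.thornKernel b α)) ∧
    (∀ α₀ ∈ Set.Ioo (0 : ℝ) 2,
      NonlocalForms.CondA α₀ (NonlocalForms.thornKernel b) ∧
      NonlocalForms.CondB α₀ (NonlocalForms.thornKernel b)) ∧
    (∀ α ∈ Set.Ioo (0 : ℝ) 2,
      ¬ NonlocalForms.SatisfiesL1 α (NonlocalForms.thornKernel b α) ∧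
      ∀ n₀ : ℕ, ¬ NonlocalForms.SatisfiesL1From n₀ α (NonlocalForms.thornKernel b α)) := by
  refine ⟨fun α hα => NonlocalForms.isAdmissible_thornKernel hb hα,
    fun α₀ hα₀ => ⟨NonlocalForms.condA_thornKernel hb hα₀.1.le,
      NonlocalForms.condB_thornKernel hb hα₀⟩,
    fun α hα => ⟨NonlocalForms.not_satisfiesL1From_thornKernel hb hα 0,
      fun n₀ => NonlocalForms.not_satisfiesL1From_thornKernel hb hα n₀⟩⟩
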